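/- For $y\in\mathbb R^3$ write $\langle y\rangle=(1+|y|^2)^{1/2}$. For $p,q>1$ and $\alpha,\beta>0$ let $X_{p,q,\alpha,\beta}$ be the space of measurable $h:\mathbb R^3\times\mathbb R^3\to\mathbb R$ with $$\|h\|_{p,q,\alpha,\beta}=\big\|\langle\alpha x\rangle^p\langle\beta v\rangle^q h(x,v)\big\|_{L^\infty_{x,v}}<\infty ,$$ let $X_{p,q,\alpha,\beta,T}=C([0,T],X_{p,q,\alpha,\beta})$, and let $|||g|||_{p,q,\alpha,\beta,T}=\sup_{t\in[0,T]}\|g(t)\|_{p,q,\alpha,\beta}$. Let $(T_1^{s}h)(x,v)=h(x-sv,v)$ be the free transport, so that $(T_1^{-t}f(t))(x,v)=f(t,x+tv,v)$. The spatially inhomogeneous 4-wave kinetic equation in dimension $3$ is $\partial_t f+v\cdot\nabla_x f=\mathcal C[f]$, $f(0)=f_0$, where, with $f=f(t,x,v)$ and $f_i=f(t,x,v_i)$, $$\mathcal C[f]=\int_{\mathbb R^9}\delta(\Sigma)\,\delta(\Omega)\,\big(f_1f_2f_3+ff_2f_3-ff_1f_3-ff_1f_2\big)\,dv_1\,dv_2\,dv_3,$$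 $\Sigma=v+v_1-v_2-v_3$, $\Omega=|v|^2+|v_1|^2-|v_2|^2-|v_3|^2$. Here, as usual, $$\int_{\mathbb R^9}\delta(\Sigma)\delta(\Omega)F(v_1,v_2,v_3)\,dv_1dv_2dv_3=\frac18\int_{\mathbb R^3\times\mathbb S^2}|v-v_1|\,F(v_1,v_2(\sigma),v_3(\sigma))\,d\sigma\,dv_1,$$ with $v_2(\sigma)=\frac{v+v_1}2+\frac{|v-v_1|}2\sigma$ and $v_3(\sigma)=\frac{v+v_1}2-\frac{|v-v_1|}2\sigma$. A measurable $f:[0,T]\times\mathbb R^3\times\mathbb R^3\to\mathbb R$ is a mild solution on $[0,T]$ with initial data $f_0\in X_{p,q,\alpha,\beta}$ if $T_1^{-(\cdot)}f(\cdot)\in X_{p,q,\alpha,\beta,T}$ and, for every $t\in[0,T]$, $$T_1^{-t}f(t)=f_0+\int_0^t T_1^{-s}\,\mathcal C[f](s)\,ds\qquad\text{for a.e. }(x,v),$$ with absolutely convergent integrals. **Theorem.** Let $p>1$, $q>3$, $\alpha,\beta>0$, $T>0$, and $$C_{p,q,\alpha,\beta}=\frac{16\,p\,\pi^3}{\alpha(p-1)}\Big(\frac13+\frac1{q-3}\Big)\max\{\beta^q,\beta^{-3q}\}.$$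 Let $0<M<(24\,C_{p,q,\alpha,\beta})^{-1/2}$ and let $f_0\in X_{p,q,\alpha,\beta}$ with $\|f_0\|_{p,q,\alpha,\beta}\le M/2$. Then there is a unique (up to equality for every $t\in[0,T]$ and a.e. $(x,v)$) mild solution $f$ on $[0,T]$ with initial data $f_0$ in the class of functions satisfying $$|||T_1^{-(\cdot)}f(\cdot)|||_{p,q,\alpha,\beta,T}\le M .$$ Moreover: 1. If $f_0\ge0$ a.e., then $f(t)\ge0$ a.e. for every $t\in[0,T]$. 2. If $g_0\in X_{p,q,\alpha,\beta}$, $\|g_0\|_{p,q,\alpha,\beta}\le M/2$, and $g$ is the mild solution in the same class with initial data $g_0$, then $$|||T_1^{-(\cdot)}f(\cdot)-T_1^{-(\cdot)}g(\cdot)|||_{p,q,\alpha,\beta,T}\le 2\,\|f_0-g_0\|_{p,q,\alpha,\beta};$$ in particular $|||T_1^{-(\cdot)}f(\cdot)|||_{p,q,\alpha,\beta,T}\le 2\|f_0\|_{p,q,\alpha,\beta}$. 3. The following conservation laws hold for every $t\in[0,T]$, with integrable integrands on both sides: - mass, if $p>3$ and $q>4$: $\int_{\mathbb R^6}f(t,x,v)\,dx\,dv=\int_{\mathbb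 R^6}f_0(x,v)\,dx\,dv$; - momentum, if $p>3$ and $q>5$: $\int_{\mathbb R^6}v\,f(t,x,v)\,dx\,dv=\int_{\mathbb R^6}v\,f_0(x,v)\,dx\,dv$; - energy, if $p>3$ and $q>6$: $\int_{\mathbb R^6}|v|^2f(t,x,v)\,dx\,dv=\int_{\mathbb R^6}|v|^2f_0(x,v)\,dx\,dv$. -/

import Mathlib

open MeasureTheory Set Filter Topology
open scoped ENNReal

namespace WaveKinetic

/-- The Euclidean space `ℝ³`, for positions and for velocities. -/
abbrev R3 : Type := EuclideanSpace ℝ (Fin 3)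

noncomputable section

/-- The bracket `⟨y⟩ = (1 + |y|²)^{1/2}`. -/
def bracket (y : R3) : ℝ := Real.sqrt (1 + ‖y‖ ^ 2)

/-- The weighted norm `‖h‖_{p,q,α,β} = ‖⟨α x⟩^p ⟨β v⟩^q h(x,v)‖_{L^∞}` (essential supremum over
`(x,v) ∈ ℝ³ × ℝ³`), with values in `[0,∞]`. -/
def wNorm (p q α β : ℝ) (h : R3 × R3 → ℝ) : ℝ≥0∞ :=
  eLpNorm (fun z : R3 × R3 => bracket (α • z.1) ^ p * bracket (β • z.2) ^ q * h z) ∞ volume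

/-- `h ∈ X_{p,q,α,β}`: Lebesgue measurable with finite weighted norm. -/
def MemX (p q α β : ℝ) (h : R3 × R3 → ℝ) : Prop :=
  AEStronglyMeasurable h volume ∧ wNorm p q α β h < ∞

/-- `g ∈ X_{p,q,α,β,T} = C([0,T], X_{p,q,α,β})`. -/
def MemXT (p q α β T : ℝ) (g : ℝ → R3 × R3 → ℝ) : Prop :=
  (∀ t ∈ Icc 0 T, MemX p q α β (g t)) ∧
  ∀ t ∈ Icc 0 T, Tendsto (fun s => wNorm p q α β (g s - g t)) (𝓝[Icc 0 T] t) (𝓝 0)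

/-- The norm `|||g|||_{p,q,α,β,T} = sup_{t ∈ [0,T]} ‖g(t)‖_{p,q,α,β}`. -/
def wNormT (p q α β T : ℝ) (g : ℝ → R3 × R3 → ℝ) : ℝ≥0∞ :=
  ⨆ t ∈ Icc 0 T, wNorm p q α β (g t)

/-- The free transport `(T₁^s h)(x,v) = h(x - s v, v)`. -/
def transport (s : ℝ) (h : R3 × R3 → ℝ) : R3 × R3 → ℝ :=
  fun z => h (z.1 - s • z.2, z.2)

/-- `T₁^{-(·)} f(·)`, the function `(t,x,v) ↦ f(t, x + t v, v)`. -/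
def pullback (f : ℝ → R3 × R3 → ℝ) : ℝ → R3 × R3 → ℝ :=
  fun t => transport (-t) (f t)

/-- The unit sphere of `ℝ³`. -/
abbrev S2 : Type := Metric.sphere (0 : R3) 1

/-- `v₂(σ) = (v + v₁)/2 + (|v - v₁|/2) σ`. -/
def vel2 (v v₁ : R3) (σ : S2) : R3 :=
  (2 : ℝ)⁻¹ • (v + v₁) + (‖v - v₁‖ / 2) • (σ : R3)

/-- `v₃(σ) = (v + v₁)/2 - (|v - v₁|/2) σ`. -/
def vel3 (v v₁ : R3) (σ : S2) : R3 :=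
  (2 : ℝ)⁻¹ • (v + v₁) - (‖v - v₁‖ / 2) • (σ : R3)

/-- The measure on the parameters `(v₁, σ) ∈ ℝ³ × S²`: Lebesgue measure times surface measure. -/
def paramMeasure : Measure (R3 × S2) :=
  (volume : Measure R3).prod (volume : Measure R3).toSphere

/-- The density, in the parameters `(v₁, σ)`, of `F(v₁, v₂, v₃)` against the measure
`δ(Σ) δ(Ω) dv₁ dv₂ dv₃`, where `Σ = v + v₁ - v₂ - v₃` and `Ω = |v|² + |v₁|² - |v₂|² - |v₃|²`.

`δ(Σ)` sets `v₃ = v + v₁ - v₂`. As a function of `v₂`, `Ω` then vanishes exactly on the sphere with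
centre `(v + v₁)/2` and radius `r = |v - v₁|/2`, on which its gradient has length
`2 |v₂ - v₃| = 4 r`; so `δ(Ω) dv₂` is the surface measure `r² dσ` of that sphere divided by `4 r`,
that is, `(|v - v₁| / 8) dσ`. -/
def resonantDensity (F : R3 → R3 → R3 → ℝ) (v : R3) : R3 × S2 → ℝ :=
  fun a => ‖v - a.1‖ / 8 * F a.1 (vel2 v a.1 a.2) (vel3 v a.1 a.2)

/-- `∫_{ℝ⁹} δ(Σ) δ(Ω) F(v₁, v₂, v₃) dv₁ dv₂ dv₃`. -/
def resonantIntegral (F : R3 → R3 → R3 → ℝ) (v : R3) : ℝ :=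
  ∫ a, resonantDensity F v a ∂paramMeasure

/-- Absolute convergence of `∫_{ℝ⁹} δ(Σ) δ(Ω) F(v₁, v₂, v₃) dv₁ dv₂ dv₃`. -/
def ResonantIntegrable (F : R3 → R3 → R3 → ℝ) (v : R3) : Prop :=
  Integrable (resonantDensity F v) paramMeasure

/-- `L₀(g,h,l)(v)`, for functions of the velocity (time and position are parameters). -/
def L0 (g h l : R3 → ℝ) (v : R3) : ℝ :=
  resonantIntegral (fun v₁ v₂ v₃ => g v₁ * h v₂ * l v₃) v

/-- `L₁(g,h,l)(v)`. -/
def L1 (g h l : R3 → ℝ) (v : R3) : ℝ :=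
  resonantIntegral (fun _ v₂ v₃ => g v * h v₂ * l v₃) v

/-- `L₂(g,h,l)(v)`. -/
def L2 (g h l : R3 → ℝ) (v : R3) : ℝ :=
  resonantIntegral (fun v₁ _ v₃ => g v * h v₁ * l v₃) v

/-- `L₃(g,h,l)(v)`. -/
def L3 (g h l : R3 → ℝ) (v : R3) : ℝ :=
  resonantIntegral (fun v₁ v₂ _ => g v * h v₁ * l v₂) v

/-- The 4-wave collision operator (gain-loss form)
`C[f] = ∫ δ(Σ) δ(Ω) (f₁ f₂ f₃ + f f₂ f₃ - f f₁ f₃ - f f₁ f₂) dv₁ dv₂ dv₃`. -/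
def collision (f : R3 → ℝ) (v : R3) : ℝ :=
  L0 f f f v + L1 f f f v - L2 f f f v - L3 f f f v

/-- Absolute convergence of the four integrals that make up `C[f](v)`. -/
def CollisionConverges (f : R3 → ℝ) (v : R3) : Prop :=
  ResonantIntegrable (fun v₁ v₂ v₃ => f v₁ * f v₂ * f v₃) v ∧
  ResonantIntegrable (fun _ v₂ v₃ => f v * f v₂ * f v₃) v ∧
  ResonantIntegrable (fun v₁ _ v₃ => f v * f v₁ * f v₃) v ∧
  ResonantIntegrable (fun v₁ v₂ _ => f v * f v₁ * f v₂) v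

/-- `C[f](s)` as a function of `(x,v)`, for `f` a function of `(s,x,v)`. -/
def collisionAt (f : ℝ → R3 × R3 → ℝ) (s : ℝ) : R3 × R3 → ℝ :=
  fun z => collision (fun w => f s (z.1, w)) z.2

/-- `f` is a mild solution on `[0,T]` with initial data `f₀`: `f` is (Lebesgue) measurable on
`[0,T] × ℝ³ × ℝ³`, `T₁^{-(·)} f(·) ∈ C([0,T], X_{p,q,α,β})`, and for every `t ∈ [0,T]`
`T₁^{-t} f(t) = f₀ + ∫₀ᵗ T₁^{-s} C[f](s) ds` as an identity between elements of `X_{p,q,α,β}`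
(almost everywhere in `(x,v)`), all the integrals being absolutely convergent. Values of `f` at
times outside `[0,T]` are irrelevant. -/
structure IsMildSolution (p q α β T : ℝ) (f₀ : R3 × R3 → ℝ) (f : ℝ → R3 × R3 → ℝ) : Prop where
  measurable : AEStronglyMeasurable (fun y : ℝ × (R3 × R3) => f y.1 y.2)
    ((volume.restrict (Icc 0 T)).prod volume)
  mem : MemXT p q α β T (pullback f)
  converges : ∀ᵐ z : R3 × R3, ∀ᵐ s ∂(volume.restrict (Icc 0 T)),
    CollisionConverges (fun w => f s (z.1 + s • z.2, w)) z.2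
  integrable : ∀ᵐ z : R3 × R3,
    IntegrableOn (fun s => transport (-s) (collisionAt f s) z) (Icc 0 T) volume
  equation : ∀ t ∈ Icc 0 T, ∀ᵐ z : R3 × R3,
    pullback f t z = f₀ z + ∫ s in (0 : ℝ)..t, transport (-s) (collisionAt f s) z

/-- The constant `C_{p,q,α,β}`. -/
def constC (p q α β : ℝ) : ℝ :=
  16 * p * Real.pi ^ 3 / (α * (p - 1)) * (1 / 3 + 1 / (q - 3)) * max (β ^ q) (β ^ (-(3 * q)))

end

end WaveKinetic

/-! Along the free flow the equation becomes a fixed-point problem for the pulled-back function: `F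
t = f₀ + duhamel F t`, where `duhamel` is cubic in `F`. The class `WtBound`, of functions bounded by
`M` times the weight `wt`, is preserved for data of size `M/2`, and `duhamel` is Lipschitz on it
with constant `3 M² C`, which the assumption on `M` makes small. The bound does not involve `T`,
because the collision term is integrable over all times.

The decisive estimate is `lintegral_kern_le`. Conservation of energy, and the same identity for the
positions traced back to time `0` (`norm_position_sq_add`), show that the weights at `v₂` and `v₃`
multiply to at most the weight at `v` and also at most the weight at `v₁`. Hence each cubic term is
at most the weight at `v` times the weight at `v₁`. The kernel `|v - v₁|` is absorbed by the time
integral of `⟨α(x + s(v - v₁))⟩^{-p}` along a line, by substitution; what remains is integrable in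
`v₁` because `q > 3`.

Continuity in time needs the same integral to be small over short time sets, uniformly in `(x, v)`.
For bounded `|v - v₁|` this is clear. For large `|v - v₁|` the smallness comes from the average over
`σ`: few outgoing velocities lie near the origin (`exists_setLIntegral_kern_le`).

Uniqueness and stability are the same Lipschitz bound, iterated. A mild solution is only known
almost everywhere, so it is replaced by measurable representatives with bounds that hold everywhere;
null sets survive collisions because the collision map preserves measure. Positivity comes from
improving a lower bound `-D wt` to `-(D/4) wt` repeatedly. The conservation laws follow from the
symmetries of the collision integral, with Fubini justified by the moments of the weight. -/

namespace WaveKinetic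

/-! ### Inequalities for the bracket. -/

section Bracket

lemma bracket_pos (y : R3) : 0 < bracket y := by unfold bracket; positivity

lemma one_le_bracket (y : R3) : 1 ≤ bracket y := by
  unfold bracket
  rw [Real.one_le_sqrt]
  nlinarith [sq_nonneg ‖y‖]

lemma bracket_sq (y : R3) : bracket y ^ 2 = 1 + ‖y‖ ^ 2 := by
  unfold bracket
  rw [Real.sq_sqrt (by positivity)]

@[fun_prop]
lemma continuous_bracket : Continuous bracket := by
  unfold bracket; fun_prop

lemma bracket_rpow_neg_pos (y : R3) (r : ℝ) : 0 < bracket y ^ r :=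
  Real.rpow_pos_of_pos (bracket_pos y) r

lemma bracket_rpow_neg_le_one (y : R3) {r : ℝ} (hr : 0 ≤ r) : bracket y ^ (-r) ≤ 1 :=
  Real.rpow_le_one_of_one_le_of_nonpos (one_le_bracket y) (by linarith)

lemma bracket_smul_sq (k : ℝ) (y : R3) : bracket (k • y) ^ 2 = 1 + k ^ 2 * ‖y‖ ^ 2 := by
  rw [bracket_sq, norm_smul, mul_pow, Real.norm_eq_abs, sq_abs]

/-- The product `(1 + A)(1 + B)` dominates `1 + A + B` for nonnegative `A`, `B`. -/
lemma bracket_le_mul (k : ℝ) {a b c : R3} (h : ‖c‖ ^ 2 ≤ ‖a‖ ^ 2 + ‖b‖ ^ 2) :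
    bracket (k • c) ≤ bracket (k • a) * bracket (k • b) := by
  have ha := bracket_pos (k • a)
  have hb := bracket_pos (k • b)
  refine le_of_sq_le_sq ?_ (by positivity)
  rw [mul_pow, bracket_smul_sq, bracket_smul_sq, bracket_smul_sq]
  have h1 : k ^ 2 * ‖c‖ ^ 2 ≤ k ^ 2 * (‖a‖ ^ 2 + ‖b‖ ^ 2) := by gcongr
  have h2 : 0 ≤ (k ^ 2 * ‖a‖ ^ 2) * (k ^ 2 * ‖b‖ ^ 2) := by positivity
  nlinarith

lemma bracket_rpow_neg_mul_le (k : ℝ) {r : ℝ} (hr : 0 ≤ r) {a b c : R3}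
    (h : ‖c‖ ^ 2 ≤ ‖a‖ ^ 2 + ‖b‖ ^ 2) :
    bracket (k • a) ^ (-r) * bracket (k • b) ^ (-r) ≤ bracket (k • c) ^ (-r) := by
  rw [← Real.mul_rpow (bracket_pos _).le (bracket_pos _).le]
  exact Real.rpow_le_rpow_of_nonpos (bracket_pos _) (bracket_le_mul k h) (by linarith)

lemma bracket_rpow_neg_le_of_half (k : ℝ) {r : ℝ} (hr : 0 ≤ r) {a c : R3}
    (h : ‖c‖ ^ 2 ≤ 2 * ‖a‖ ^ 2) :
    bracket (k • a) ^ (-r) ≤ 2 ^ (r / 2) * bracket (k • c) ^ (-r) := by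
  have h1 : (2 : ℝ) ^ (r / 2) = (√2) ^ r := by
    rw [Real.sqrt_eq_rpow, ← Real.rpow_mul (by norm_num)]; congr 1; ring
  have hc := bracket_pos (k • c)
  have ha := bracket_pos (k • a)
  have key : bracket (k • c) ≤ √2 * bracket (k • a) := by
    refine le_of_sq_le_sq ?_ (by positivity)
    rw [mul_pow, bracket_smul_sq, bracket_smul_sq, Real.sq_sqrt (by norm_num)]
    have : k ^ 2 * ‖c‖ ^ 2 ≤ k ^ 2 * (2 * ‖a‖ ^ 2) := by gcongr
    nlinarith
  have h2 : bracket (k • c) ^ r ≤ (√2) ^ r * bracket (k • a) ^ r := by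
    rw [← Real.mul_rpow (by positivity) ha.le]
    exact Real.rpow_le_rpow hc.le key hr
  rw [h1, Real.rpow_neg ha.le, Real.rpow_neg hc.le, ← div_eq_mul_inv, le_div_iff₀ (by positivity),
    inv_mul_le_iff₀ (by positivity), mul_comm]
  exact h2

/-- The longer of `a`, `b` carries at least half of `‖c‖²`, so its factor is already comparable with
that of `c`. The factor of the shorter one is left over, and is kept as a source of smallness. -/
lemma bracket_rpow_neg_mul_le_add (k : ℝ) {r : ℝ} (hr : 0 ≤ r) {a b c : R3}
    (h : ‖c‖ ^ 2 ≤ ‖a‖ ^ 2 + ‖b‖ ^ 2) :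
    bracket (k • a) ^ (-r) * bracket (k • b) ^ (-r) ≤
      2 ^ (r / 2) * bracket (k • c) ^ (-r) *
        (bracket (k • a) ^ (-r) + bracket (k • b) ^ (-r)) := by
  have hc := bracket_rpow_neg_pos (k • c) (-r)
  have ha := bracket_rpow_neg_pos (k • a) (-r)
  have hb := bracket_rpow_neg_pos (k • b) (-r)
  have h2 : (0 : ℝ) < 2 ^ (r / 2) := by positivity
  have hcc : 0 < 2 ^ (r / 2) * bracket (k • c) ^ (-r) := by positivity
  rcases le_total ‖a‖ ‖b‖ with hab | hab
  · have := bracket_rpow_neg_le_of_half k hr (a := b) (c := c)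
      (by nlinarith [norm_nonneg a, norm_nonneg b])
    nlinarith
  · have := bracket_rpow_neg_le_of_half k hr (a := a) (c := c)
      (by nlinarith [norm_nonneg a, norm_nonneg b])
    nlinarith

end Bracket

/-! ### Conserved quantities of a collision. -/

section Velocities

lemma vel2_add_vel3 (v v₁ : R3) (σ : S2) : vel2 v v₁ σ + vel3 v v₁ σ = v + v₁ := by
  unfold vel2 vel3
  module

lemma norm_add_sq_add_norm_sub_sq (m d e : R3) (h : ‖d‖ = ‖e‖) :
    ‖m + d‖ ^ 2 + ‖m - d‖ ^ 2 = ‖m + e‖ ^ 2 + ‖m - e‖ ^ 2 := by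
  have h1 := parallelogram_law_with_norm ℝ m d
  have h2 := parallelogram_law_with_norm ℝ m e
  rw [h] at h1
  nlinarith

lemma norm_half_smul_sphere (u : R3) (σ : S2) :
    ‖(‖u‖ / 2) • (σ : R3)‖ = ‖(2 : ℝ)⁻¹ • u‖ := by
  rw [norm_smul, norm_smul, norm_eq_of_mem_sphere]
  simp
  ring

lemma norm_vel2_sq_add_norm_vel3_sq (v v₁ : R3) (σ : S2) :
    ‖vel2 v v₁ σ‖ ^ 2 + ‖vel3 v v₁ σ‖ ^ 2 = ‖v‖ ^ 2 + ‖v₁‖ ^ 2 := by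
  unfold vel2 vel3
  rw [norm_add_sq_add_norm_sub_sq _ _ _ (norm_half_smul_sphere (v - v₁) σ)]
  congr 3 <;> module

/-- Both pairs of positions have the midpoint `x + (s/2)(v - v₁)` and half-differences of equal
length, so the parallelogram law applies. This is the spatial counterpart of conservation of energy.
-/
lemma norm_position_sq_add (x v v₁ : R3) (σ : S2) (s : ℝ) :
    ‖x + s • (v - vel2 v v₁ σ)‖ ^ 2 + ‖x + s • (v - vel3 v v₁ σ)‖ ^ 2 =
      ‖x‖ ^ 2 + ‖x + s • (v - v₁)‖ ^ 2 := by
  have h := norm_add_sq_add_norm_sub_sq (x + (s / 2) • (v - v₁)) (-s • (‖v - v₁‖ / 2) • (σ : R3))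
    (-s • (2 : ℝ)⁻¹ • (v - v₁)) (by rw [norm_smul (-s), norm_smul (-s), norm_half_smul_sphere])
  convert h using 4 <;> (try unfold vel2) <;> (try unfold vel3) <;> module

lemma norm_vel2_sub_vel3 (v v₁ : R3) (σ : S2) :
    ‖vel2 v v₁ σ - vel3 v v₁ σ‖ = ‖v - v₁‖ := by
  have : vel2 v v₁ σ - vel3 v v₁ σ = ‖v - v₁‖ • (σ : R3) := by
    unfold vel2 vel3; module
  rw [this, norm_smul, norm_eq_of_mem_sphere]; simp

end Velocities

/-! ### Weights along a collision. -/

noncomputable section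

/-- The weight `⟨α x⟩^{-p} ⟨β v⟩^{-q}`. -/
def wt (p q α β : ℝ) (z : R3 × R3) : ℝ :=
  bracket (α • z.1) ^ (-p) * bracket (β • z.2) ^ (-q)

/-- The point that moves with velocity `w`, and is at time `s` where the particle that starts at
`z` is, traced back to time `0`. -/
def along (s : ℝ) (z : R3 × R3) (w : R3) : R3 × R3 := (z.1 + s • (z.2 - w), w)

end

variable {p q α β : ℝ}

lemma wt_pos (z : R3 × R3) : 0 < wt p q α β z :=
  mul_pos (bracket_rpow_neg_pos _ _) (bracket_rpow_neg_pos _ _)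

lemma wt_le_one (hp : 0 ≤ p) (hq : 0 ≤ q) (z : R3 × R3) : wt p q α β z ≤ 1 :=
  mul_le_one₀ (bracket_rpow_neg_le_one _ hp) (bracket_rpow_neg_pos _ _).le
    (bracket_rpow_neg_le_one _ hq)

lemma wt_le_velocity (hp : 0 ≤ p) (z : R3 × R3) : wt p q α β z ≤ bracket (β • z.2) ^ (-q) :=
  mul_le_of_le_one_left (bracket_rpow_neg_pos _ _).le (bracket_rpow_neg_le_one _ hp)

@[fun_prop]
lemma continuous_wt : Continuous (wt p q α β) := by
  unfold wt
  refine Continuous.mul ?_ ?_ <;>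
  exact Continuous.rpow_const (by fun_prop) fun z => Or.inl (bracket_pos _).ne'

lemma along_self (s : ℝ) (z : R3 × R3) : along s z z.2 = z := by
  simp [along]

/-- The two quadratic identities make `bracket_rpow_neg_mul_le` applicable to the position factor
and to the velocity factor separately. -/
lemma wt_vel_mul_le_left (hp : 0 ≤ p) (hq : 0 ≤ q) (s : ℝ) (z : R3 × R3) (v₁ : R3) (σ : S2) :
    wt p q α β (along s z (vel2 z.2 v₁ σ)) * wt p q α β (along s z (vel3 z.2 v₁ σ)) ≤
      wt p q α β z := by
  have h1 := bracket_rpow_neg_mul_le α hp (c := z.1)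
    (a := z.1 + s • (z.2 - vel2 z.2 v₁ σ)) (b := z.1 + s • (z.2 - vel3 z.2 v₁ σ))
    (by rw [norm_position_sq_add]; nlinarith [sq_nonneg ‖z.1 + s • (z.2 - v₁)‖])
  have h2 := bracket_rpow_neg_mul_le β hq (c := z.2) (a := vel2 z.2 v₁ σ) (b := vel3 z.2 v₁ σ)
    (by rw [norm_vel2_sq_add_norm_vel3_sq]; nlinarith [sq_nonneg ‖v₁‖])
  have h := mul_le_mul h1 h2 (mul_pos (bracket_rpow_neg_pos _ _) (bracket_rpow_neg_pos _ _)).le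
    (bracket_rpow_neg_pos _ _).le
  unfold wt along
  refine le_of_eq_of_le ?_ h
  dsimp only
  ring

lemma wt_vel_mul_le_right (hp : 0 ≤ p) (hq : 0 ≤ q) (s : ℝ) (z : R3 × R3) (v₁ : R3) (σ : S2) :
    wt p q α β (along s z (vel2 z.2 v₁ σ)) * wt p q α β (along s z (vel3 z.2 v₁ σ)) ≤
      wt p q α β (along s z v₁) := by
  have h1 := bracket_rpow_neg_mul_le α hp (c := z.1 + s • (z.2 - v₁))
    (a := z.1 + s • (z.2 - vel2 z.2 v₁ σ)) (b := z.1 + s • (z.2 - vel3 z.2 v₁ σ))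
    (by rw [norm_position_sq_add]; nlinarith [sq_nonneg ‖z.1‖])
  have h2 := bracket_rpow_neg_mul_le β hq (c := v₁) (a := vel2 z.2 v₁ σ) (b := vel3 z.2 v₁ σ)
    (by rw [norm_vel2_sq_add_norm_vel3_sq]; nlinarith [sq_nonneg ‖z.2‖])
  have h := mul_le_mul h1 h2 (mul_pos (bracket_rpow_neg_pos _ _) (bracket_rpow_neg_pos _ _)).le
    (bracket_rpow_neg_pos _ _).le
  unfold wt along
  refine le_of_eq_of_le ?_ h
  dsimp only
  ring

noncomputable section

/-- The velocity factor `⟨β v₂⟩^{-q} + ⟨β v₃⟩^{-q}`. -/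
def velGain (q β : ℝ) (v v₁ : R3) (σ : S2) : ℝ :=
  bracket (β • vel2 v v₁ σ) ^ (-q) + bracket (β • vel3 v v₁ σ) ^ (-q)

end

lemma velGain_pos (v v₁ : R3) (σ : S2) : 0 < velGain q β v v₁ σ :=
  add_pos (bracket_rpow_neg_pos _ _) (bracket_rpow_neg_pos _ _)

lemma wt_vel_mul_le_gain_left (hp : 0 ≤ p) (hq : 0 ≤ q) (s : ℝ) (z : R3 × R3) (v₁ : R3) (σ : S2) :
    wt p q α β (along s z (vel2 z.2 v₁ σ)) * wt p q α β (along s z (vel3 z.2 v₁ σ)) ≤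
      2 ^ (q / 2) * wt p q α β z * velGain q β z.2 v₁ σ := by
  have h1 := bracket_rpow_neg_mul_le α hp (c := z.1)
    (a := z.1 + s • (z.2 - vel2 z.2 v₁ σ)) (b := z.1 + s • (z.2 - vel3 z.2 v₁ σ))
    (by rw [norm_position_sq_add]; nlinarith [sq_nonneg ‖z.1 + s • (z.2 - v₁)‖])
  have h2 := bracket_rpow_neg_mul_le_add β hq (c := z.2) (a := vel2 z.2 v₁ σ)
    (b := vel3 z.2 v₁ σ) (by rw [norm_vel2_sq_add_norm_vel3_sq]; nlinarith [sq_nonneg ‖v₁‖])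
  have h := mul_le_mul h1 h2 (mul_pos (bracket_rpow_neg_pos _ _) (bracket_rpow_neg_pos _ _)).le
    (bracket_rpow_neg_pos _ _).le
  unfold wt along velGain
  refine le_of_eq_of_le ?_ (h.trans_eq ?_) <;> (try dsimp only) <;> ring

lemma wt_vel_mul_le_gain_right (hp : 0 ≤ p) (hq : 0 ≤ q) (s : ℝ) (z : R3 × R3) (v₁ : R3)
    (σ : S2) :
    wt p q α β (along s z (vel2 z.2 v₁ σ)) * wt p q α β (along s z (vel3 z.2 v₁ σ)) ≤
      2 ^ (q / 2) * wt p q α β (along s z v₁) * velGain q β z.2 v₁ σ := by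
  have h1 := bracket_rpow_neg_mul_le α hp (c := z.1 + s • (z.2 - v₁))
    (a := z.1 + s • (z.2 - vel2 z.2 v₁ σ)) (b := z.1 + s • (z.2 - vel3 z.2 v₁ σ))
    (by rw [norm_position_sq_add]; nlinarith [sq_nonneg ‖z.1‖])
  have h2 := bracket_rpow_neg_mul_le_add β hq (c := v₁) (a := vel2 z.2 v₁ σ)
    (b := vel3 z.2 v₁ σ) (by rw [norm_vel2_sq_add_norm_vel3_sq]; nlinarith [sq_nonneg ‖z.2‖])
  have h := mul_le_mul h1 h2 (mul_pos (bracket_rpow_neg_pos _ _) (bracket_rpow_neg_pos _ _)).le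
    (bracket_rpow_neg_pos _ _).le
  unfold wt along velGain
  refine le_of_eq_of_le ?_ (h.trans_eq ?_) <;> (try dsimp only) <;> ring

noncomputable section

/-- The sum of the four products of three of the weights along a collision. -/
def tripleSum (p q α β : ℝ) (s : ℝ) (z : R3 × R3) (a : R3 × S2) : ℝ :=
  wt p q α β (along s z a.1) * wt p q α β (along s z (vel2 z.2 a.1 a.2)) *
      wt p q α β (along s z (vel3 z.2 a.1 a.2)) +
    wt p q α β z * wt p q α β (along s z (vel2 z.2 a.1 a.2)) *
      wt p q α β (along s z (vel3 z.2 a.1 a.2)) +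
    wt p q α β z * wt p q α β (along s z a.1) * wt p q α β (along s z (vel3 z.2 a.1 a.2)) +
    wt p q α β z * wt p q α β (along s z a.1) * wt p q α β (along s z (vel2 z.2 a.1 a.2))

end

/-- In the first two terms the weights at `v₂` and `v₃` are traded for the one that is missing; in
the last two the third weight is at most `1`. -/
lemma tripleSum_le (hp : 0 ≤ p) (hq : 0 ≤ q) (s : ℝ) (z : R3 × R3) (a : R3 × S2) :
    tripleSum p q α β s z a ≤ 4 * (wt p q α β z * wt p q α β (along s z a.1)) := by
  have hl := wt_vel_mul_le_left (α := α) (β := β) hp hq s z a.1 a.2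
  have hr := wt_vel_mul_le_right (α := α) (β := β) hp hq s z a.1 a.2
  have h2 := wt_le_one (α := α) (β := β) hp hq (along s z (vel2 z.2 a.1 a.2))
  have h3 := wt_le_one (α := α) (β := β) hp hq (along s z (vel3 z.2 a.1 a.2))
  have p0 := wt_pos (p := p) (q := q) (α := α) (β := β) z
  have p1 := wt_pos (p := p) (q := q) (α := α) (β := β) (along s z a.1)
  have p01 := mul_pos p0 p1
  unfold tripleSum
  have e1 := mul_le_mul_of_nonneg_left hl p1.le
  have e2 := mul_le_mul_of_nonneg_left hr p0.le
  have e3 := mul_le_mul_of_nonneg_left h2 p01.le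
  have e4 := mul_le_mul_of_nonneg_left h3 p01.le
  nlinarith

/-- A refinement of `tripleSum_le` that keeps one factor decaying in an outgoing velocity. The first
two terms contribute `2^{q/2}` each, and the last two together at most one more. -/
lemma tripleSum_le_gain (hp : 0 ≤ p) (hq : 0 ≤ q) (s : ℝ) (z : R3 × R3) (a : R3 × S2) :
    tripleSum p q α β s z a ≤
      3 * 2 ^ (q / 2) * (wt p q α β z * wt p q α β (along s z a.1) * velGain q β z.2 a.1 a.2) := by
  have hl := wt_vel_mul_le_gain_left (α := α) (β := β) hp hq s z a.1 a.2
  have hr := wt_vel_mul_le_gain_right (α := α) (β := β) hp hq s z a.1 a.2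
  have h2 := wt_le_velocity (q := q) (α := α) (β := β) hp (along s z (vel2 z.2 a.1 a.2))
  have h3 := wt_le_velocity (q := q) (α := α) (β := β) hp (along s z (vel3 z.2 a.1 a.2))
  have p0 := wt_pos (p := p) (q := q) (α := α) (β := β) z
  have p1 := wt_pos (p := p) (q := q) (α := α) (β := β) (along s z a.1)
  have p01 := mul_pos p0 p1
  have pg := velGain_pos (q := q) (β := β) z.2 a.1 a.2
  have c1 : (1 : ℝ) ≤ 2 ^ (q / 2) := Real.one_le_rpow (by norm_num) (by positivity)
  unfold tripleSum
  have e1 := mul_le_mul_of_nonneg_left hl p1.le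
  have e2 := mul_le_mul_of_nonneg_left hr p0.le
  have e3 := mul_le_mul_of_nonneg_left (add_le_add h2 h3) p01.le
  have e4 := mul_le_mul_of_nonneg_right c1 (mul_pos p01 pg).le
  unfold velGain at *
  dsimp only [along] at *
  nlinarith

lemma tripleSum_pos (s : ℝ) (z : R3 × R3) (a : R3 × S2) : 0 < tripleSum p q α β s z a := by
  have h := fun z => wt_pos (p := p) (q := q) (α := α) (β := β) z
  unfold tripleSum
  have h0 := h z
  have h1 := h (along s z a.1)
  have h2 := h (along s z (vel2 z.2 a.1 a.2))
  have h3 := h (along s z (vel3 z.2 a.1 a.2))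
  positivity

/-! ### Integrals of the bracket over space and along lines. -/

section Radial

/-- The integrand is at most `y^n` on `(0, 1]` and `y^{n-r}` beyond `1`; the two summands of the
bound are the integrals of these. -/
lemma integrableOn_integral_radial_le (n : ℕ) {r : ℝ} (hr : (n : ℝ) + 1 < r) :
    IntegrableOn (fun y : ℝ => y ^ n * √(1 + y ^ 2) ^ (-r)) (Ioi 0) ∧
      ∫ y in Ioi (0 : ℝ), y ^ n * √(1 + y ^ 2) ^ (-r) ≤ 1 / ((n : ℝ) + 1) + 1 / (r - (n + 1)) := by
  have hn : (0 : ℝ) ≤ n := n.cast_nonneg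
  have hcont : Continuous fun y : ℝ => y ^ n * √(1 + y ^ 2) ^ (-r) := by
    refine Continuous.mul (by fun_prop) (Continuous.rpow_const (by fun_prop) fun y => Or.inl ?_)
    positivity
  have h1 : IntegrableOn (fun y : ℝ => y ^ n) (Ioc 0 1) :=
    (continuous_pow n).integrableOn_Ioc
  have h2 : IntegrableOn (fun y : ℝ => y ^ ((n : ℝ) - r)) (Ioi 1) :=
    integrableOn_Ioi_rpow_of_lt (by linarith) one_pos
  have b1 : ∀ y ∈ Ioc (0 : ℝ) 1, y ^ n * √(1 + y ^ 2) ^ (-r) ≤ y ^ n := fun y hy =>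
    mul_le_of_le_one_right (pow_nonneg hy.1.le _)
      (Real.rpow_le_one_of_one_le_of_nonpos (by rw [Real.one_le_sqrt]; nlinarith [sq_nonneg y])
        (by linarith))
  have b2 : ∀ y ∈ Ioi (1 : ℝ), y ^ n * √(1 + y ^ 2) ^ (-r) ≤ y ^ ((n : ℝ) - r) := fun y hy => by
    have hy0 : (0 : ℝ) < y := one_pos.trans hy
    rw [sub_eq_add_neg, Real.rpow_add hy0, Real.rpow_natCast]
    refine mul_le_mul_of_nonneg_left ?_ (by positivity)
    refine Real.rpow_le_rpow_of_nonpos hy0 ?_ (by linarith)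
    exact Real.le_sqrt_of_sq_le (by linarith)
  have nn : ∀ y : ℝ, 0 < y → 0 ≤ y ^ n * √(1 + y ^ 2) ^ (-r) := fun y hy => by positivity
  have i1 : IntegrableOn (fun y : ℝ => y ^ n * √(1 + y ^ 2) ^ (-r)) (Ioc 0 1) :=
    hcont.integrableOn_Ioc
  have i2 : IntegrableOn (fun y : ℝ => y ^ n * √(1 + y ^ 2) ^ (-r)) (Ioi 1) := by
    refine h2.mono' hcont.aestronglyMeasurable ?_
    filter_upwards [ae_restrict_mem measurableSet_Ioi] with y hy
    rw [Real.norm_of_nonneg (nn y (one_pos.trans hy))]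
    exact b2 y hy
  have hU : Ioc (0 : ℝ) 1 ∪ Ioi 1 = Ioi 0 := Ioc_union_Ioi_eq_Ioi zero_le_one
  rw [← hU]
  refine ⟨i1.union i2, ?_⟩
  rw [setIntegral_union Ioc_disjoint_Ioi_same measurableSet_Ioi i1 i2]
  refine add_le_add ((setIntegral_mono_on i1 h1 measurableSet_Ioc b1).trans_eq ?_)
    ((setIntegral_mono_on i2 h2 measurableSet_Ioi b2).trans_eq ?_)
  · rw [← intervalIntegral.integral_of_le zero_le_one, integral_pow]; simp
  · rw [integral_Ioi_rpow_of_lt (by linarith) one_pos, Real.one_rpow, neg_div,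
      ← div_neg]
    congr 1; ring

lemma integrable_integral_norm_bracket_le {E : Type*} [NormedAddCommGroup E] [NormedSpace ℝ E]
    [FiniteDimensional ℝ E] [MeasurableSpace E] [BorelSpace E] (μ : Measure E)
    [μ.IsAddHaarMeasure] (n : ℕ) (hn : Module.finrank ℝ E = n + 1) {r : ℝ}
    (hr : (n : ℝ) + 1 < r) :
    Integrable (fun x : E => √(1 + ‖x‖ ^ 2) ^ (-r)) μ ∧
      ∫ x, √(1 + ‖x‖ ^ 2) ^ (-r) ∂μ ≤
        (n + 1) * μ.real (Metric.ball 0 1) * (1 / ((n : ℝ) + 1) + 1 / (r - (n + 1))) := by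
  have : Nontrivial E := Module.nontrivial_of_finrank_pos (R := ℝ) (by omega)
  obtain ⟨h1, h2⟩ := integrableOn_integral_radial_le n hr
  constructor
  · rw [integrable_fun_norm_addHaar μ (f := fun y => √(1 + y ^ 2) ^ (-r)), hn]
    simpa using h1
  · rw [integral_fun_norm_addHaar μ (fun y => √(1 + y ^ 2) ^ (-r)), hn]
    simp only [Nat.add_sub_cancel, smul_eq_mul, nsmul_eq_mul, Nat.cast_add, Nat.cast_one]
    rw [mul_assoc]
    gcongr

lemma integrable_bracket_rpow {β q : ℝ} (hβ : 0 < β) (hq : 3 < q) :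
    Integrable (fun v : R3 => bracket (β • v) ^ (-q)) ∧
      ∫ v : R3, bracket (β • v) ^ (-q) ≤
        4 * Real.pi * (β ^ 3)⁻¹ * (1 / 3 + 1 / (q - 3)) := by
  obtain ⟨h1, h2⟩ := integrable_integral_norm_bracket_le (volume : Measure R3) 2
    (by simp) (r := q) (by norm_num; linarith)
  refine ⟨(integrable_comp_smul_iff volume (fun v : R3 => bracket v ^ (-q)) hβ.ne').2 h1, ?_⟩
  rw [Measure.integral_comp_smul volume (fun v : R3 => bracket v ^ (-q)) β]
  have hb : (volume : Measure R3).real (Metric.ball 0 1) = Real.pi * 4 / 3 := by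
    rw [measureReal_def, EuclideanSpace.volume_ball_fin_three]
    simp
    positivity
  rw [hb] at h2
  have h3 : |(β ^ Module.finrank ℝ R3)⁻¹| = (β ^ 3)⁻¹ := by
    simp [abs_of_pos hβ]
  rw [h3, smul_eq_mul]
  have h4 : (0 : ℝ) ≤ (β ^ 3)⁻¹ := by positivity
  refine (mul_le_mul_of_nonneg_left h2 h4).trans_eq ?_
  push_cast
  ring

lemma lintegral_bracket_velocity_le {β q : ℝ} (hβ : 0 < β) (hq : 3 < q) :
    ∫⁻ v : R3, ENNReal.ofReal (bracket (β • v) ^ (-q)) ≤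
      ENNReal.ofReal (4 * Real.pi * (β ^ 3)⁻¹ * (1 / 3 + 1 / (q - 3))) := by
  obtain ⟨h1, h2⟩ := integrable_bracket_rpow hβ hq
  rw [← ofReal_integral_eq_lintegral_ofReal h1
    (Eventually.of_forall fun v => (bracket_rpow_neg_pos _ _).le)]
  exact ENNReal.ofReal_le_ofReal h2

/-- The substitution `τ = α ‖u‖ (s - s₀)` consumes the factor `‖u‖`, so the bound is uniform in the
line and in its speed. This is how dispersion controls the unbounded collision kernel. -/
lemma lintegral_bracket_line_le {α p : ℝ} (hα : 0 < α) (hp : 1 < p) (x u : R3) :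
    ∫⁻ s : ℝ, ENNReal.ofReal (‖u‖ * bracket (α • (x + s • u)) ^ (-p)) ≤
      ENNReal.ofReal (2 * p / (α * (p - 1))) := by
  rcases eq_or_ne u 0 with rfl | hu
  · simp
  have hu' : 0 < ‖u‖ := norm_pos_iff.2 hu
  obtain ⟨h1, h2⟩ := integrable_integral_norm_bracket_le (volume : Measure ℝ) 0
    (by simp) (r := p) (by simpa using hp)
  set g : ℝ → ℝ := fun τ => √(1 + ‖τ‖ ^ 2) ^ (-p) with hg
  set k : ℝ := α * ‖u‖ with hk
  have hk0 : 0 < k := by positivity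
  -- The time at which the line is closest to the origin, so that `‖x + s u‖ ≥ ‖u‖ |s - s₀|`.
  set s₀ : ℝ := -(inner ℝ x u) / ‖u‖ ^ 2 with hs₀
  have hle : ∀ s : ℝ, bracket (α • (x + s • u)) ^ (-p) ≤ g (k • (s - s₀)) := fun s => by
    refine Real.rpow_le_rpow_of_nonpos (by positivity) ?_ (by linarith)
    refine Real.sqrt_le_sqrt ?_
    gcongr 1 + ?_
    rw [norm_smul, norm_smul, mul_pow, mul_pow, hk, norm_mul, norm_norm, mul_pow, mul_assoc]
    gcongr
    rw [Real.norm_eq_abs, sq_abs]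
    have e : ‖x + s • u‖ ^ 2 = ‖x‖ ^ 2 + 2 * s * inner ℝ x u + s ^ 2 * ‖u‖ ^ 2 := by
      rw [norm_add_sq_real, inner_smul_right, norm_smul, mul_pow, Real.norm_eq_abs, sq_abs]; ring
    have e2 : ‖u‖ ^ 2 * (s - s₀) ^ 2 =
        s ^ 2 * ‖u‖ ^ 2 + 2 * s * inner ℝ x u + (inner ℝ x u) ^ 2 / ‖u‖ ^ 2 := by
      rw [hs₀]; field_simp; ring
    rw [e, e2]
    have e3 : (inner ℝ x u) ^ 2 / ‖u‖ ^ 2 ≤ ‖x‖ ^ 2 := by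
      rw [div_le_iff₀ (by positivity), ← mul_pow]
      exact sq_le_sq' (by linarith [neg_le_of_abs_le (abs_real_inner_le_norm x u)])
        (real_inner_le_norm x u)
    linarith
  have i1 : Integrable fun s : ℝ => g (k • (s - s₀)) :=
    ((integrable_comp_smul_iff volume g hk0.ne').2 h1).comp_sub_right s₀
  calc ∫⁻ s : ℝ, ENNReal.ofReal (‖u‖ * bracket (α • (x + s • u)) ^ (-p))
      ≤ ∫⁻ s : ℝ, ENNReal.ofReal (‖u‖ * g (k • (s - s₀))) := by
        refine lintegral_mono fun s => ENNReal.ofReal_le_ofReal ?_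
        exact mul_le_mul_of_nonneg_left (hle s) hu'.le
    _ = ENNReal.ofReal (∫ s : ℝ, ‖u‖ * g (k • (s - s₀))) := by
        rw [ofReal_integral_eq_lintegral_ofReal (i1.const_mul _)]
        exact Eventually.of_forall fun s => by positivity
    _ ≤ _ := by
        refine ENNReal.ofReal_le_ofReal ?_
        rw [integral_const_mul, integral_sub_right_eq_self (fun s => g (k • s)) s₀,
          Measure.integral_comp_smul]
        have hb : (volume : Measure ℝ).real (Metric.ball 0 1) = 2 := by
          simp [measureReal_def]
        rw [hb] at h2
        have h3 : |(k ^ Module.finrank ℝ ℝ)⁻¹| = k⁻¹ := by simp [abs_of_pos hk0]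
        rw [h3, smul_eq_mul]
        have : p - 1 ≠ 0 := by linarith
        calc ‖u‖ * (k⁻¹ * ∫ x, g x) = α⁻¹ * ∫ x, g x := by
              rw [hk]; field_simp
          _ ≤ α⁻¹ * _ := mul_le_mul_of_nonneg_left h2 (by positivity)
          _ = _ := by simp only [Nat.cast_zero, zero_add, one_mul, div_one]; field_simp; ring

end Radial

/-! ### Averages over the sphere of outgoing directions. -/

section Sphere

open scoped Pointwise

lemma toSphere_univ_eq : (volume : Measure R3).toSphere univ = ENNReal.ofReal (4 * Real.pi) := by
  rw [Measure.toSphere_apply_univ, EuclideanSpace.volume_ball_fin_three]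
  simp only [finrank_euclideanSpace, Fintype.card_fin]
  rw [← ENNReal.ofReal_natCast, ← ENNReal.ofReal_pow (by norm_num), ← ENNReal.ofReal_mul (by norm_num), ← ENNReal.ofReal_mul (by norm_num)]
  congr 1; push_cast; ring

instance : IsFiniteMeasure (volume : Measure R3).toSphere := inferInstance

instance : SFinite ((volume : Measure R3).prod (volume : Measure R3).toSphere) := inferInstance

instance : SigmaFinite ((volume : Measure R3).prod (volume : Measure R3).toSphere) := inferInstance

instance : SFinite paramMeasure := by unfold paramMeasure; infer_instance

instance : SigmaFinite paramMeasure := by unfold paramMeasure; infer_instance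

/-- The surface measure is three times the volume of the cone over the cap. The cone is covered by
`N` balls of radius `2/N` centred along the segment towards `σ₀`, of total volume `N (2/N)³ 4π/3`.
-/
lemma toSphere_cap_le (σ₀ : S2) {N : ℕ} (hN : 0 < N) :
    (volume : Measure R3).toSphere {σ : S2 | ‖(σ : R3) - σ₀‖ ≤ 1 / N} ≤
      ENNReal.ofReal (32 * Real.pi / (N : ℝ) ^ 2) := by
  have hN' : (0 : ℝ) < N := by exact_mod_cast hN
  have hm : MeasurableSet {σ : S2 | ‖(σ : R3) - σ₀‖ ≤ 1 / N} :=
    measurableSet_le (by fun_prop) measurable_const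
  rw [Measure.toSphere_apply' _ hm]
  have hsub : Ioo (0 : ℝ) 1 • ((↑) '' {σ : S2 | ‖(σ : R3) - σ₀‖ ≤ 1 / N} : Set R3) ⊆
      ⋃ i ∈ Finset.range N, Metric.closedBall (((i : ℝ) / N) • (σ₀ : R3)) (2 / N) := by
    rintro _ ⟨t, ht, _, ⟨σ, hσ, rfl⟩, rfl⟩
    have htN : 0 ≤ t * N := mul_nonneg ht.1.le hN'.le
    have hfl := Nat.floor_le htN
    have hfl2 := Nat.lt_floor_add_one (t * N)
    simp only [Finset.mem_range, mem_iUnion, Metric.mem_closedBall]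
    -- The ball is chosen by rounding the radius down to a multiple of `1/N`: rounding and the
    -- opening of the cap each cost at most `1/N`.
    refine ⟨⌊t * N⌋₊, ?_, ?_⟩
    · rw [Nat.floor_lt htN]; nlinarith [ht.2]
    · have e : t • (σ : R3) - ((⌊t * N⌋₊ : ℝ) / N) • (σ₀ : R3) =
          t • ((σ : R3) - σ₀) + (t - (⌊t * N⌋₊ : ℝ) / N) • (σ₀ : R3) := by module
      rw [dist_eq_norm]
      rw [e]
      refine (norm_add_le _ _).trans ?_
      rw [norm_smul, norm_smul, norm_eq_of_mem_sphere, mul_one, Real.norm_of_nonneg ht.1.le,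
        Real.norm_of_nonneg (by rw [sub_nonneg, div_le_iff₀ hN']; exact hfl)]
      have h1 : t * ‖(σ : R3) - σ₀‖ ≤ 1 / N :=
        (mul_le_of_le_one_left (norm_nonneg _) ht.2.le).trans hσ
      have h2 : t - (⌊t * N⌋₊ : ℝ) / N ≤ 1 / N := by
        rw [tsub_le_iff_right, ← add_div, le_div_iff₀ hN']; linarith
      calc _ ≤ 1 / (N : ℝ) + 1 / N := add_le_add h1 h2
        _ = 2 / N := by ring
  have hvol : volume (Ioo (0 : ℝ) 1 • ((↑) '' {σ : S2 | ‖(σ : R3) - σ₀‖ ≤ 1 / N} : Set R3)) ≤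
      N * (ENNReal.ofReal (2 / N) ^ 3 * ENNReal.ofReal (Real.pi * 4 / 3)) := by
    refine (measure_mono hsub).trans ((measure_biUnion_finset_le _ _).trans ?_)
    simp [EuclideanSpace.volume_closedBall_fin_three]
  refine (mul_le_mul_right hvol _).trans_eq ?_
  rw [finrank_euclideanSpace, Fintype.card_fin, ← ENNReal.ofReal_natCast, ← ENNReal.ofReal_natCast N,
    ← ENNReal.ofReal_pow (by positivity), ← ENNReal.ofReal_mul (by positivity),
    ← ENNReal.ofReal_mul (by positivity), ← ENNReal.ofReal_mul (by positivity)]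
  congr 1
  push_cast
  field_simp
  ring

/-- A large sphere, wherever its centre, meets a fixed ball around the origin only in a small cap;
off that ball the integrand is small. Negative `r` is allowed so that `vel3` is covered as well as
`vel2`. -/
lemma exists_forall_lintegral_sphere_bracket_le {β q : ℝ} (hβ : 0 < β) (hq : 0 < q) {ε : ℝ}
    (hε : 0 < ε) : ∃ R : ℝ, 0 < R ∧ ∀ r : ℝ, R ≤ |r| → ∀ c : R3,
      ∫⁻ σ : S2, ENNReal.ofReal (bracket (β • (c + r • (σ : R3))) ^ (-q))
        ∂(volume : Measure R3).toSphere ≤ ENNReal.ofReal ε := by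
  have hη : 0 < ε / (8 * Real.pi) := by positivity
  obtain ⟨L, hL0, hL⟩ : ∃ L : ℝ, 0 < L ∧
      ∀ y : R3, L ≤ ‖y‖ → bracket (β • y) ^ (-q) ≤ ε / (8 * Real.pi) := by
    have h := (tendsto_rpow_neg_atTop hq).eventually (Iio_mem_nhds hη)
    obtain ⟨K, hK⟩ := (h.and (eventually_gt_atTop 0)).exists_forall_of_atTop
    have hK0 : 0 < K := (hK K le_rfl).2
    refine ⟨K / β, by positivity, fun y hy => ?_⟩
    refine le_trans ?_ (hK K le_rfl).1.le
    refine Real.rpow_le_rpow_of_nonpos hK0 ?_ (by linarith)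
    refine Real.le_sqrt_of_sq_le ?_
    rw [div_le_iff₀ hβ] at hy
    rw [norm_smul, Real.norm_of_nonneg hβ.le]
    nlinarith
  -- As `N > 1`, the cap has measure at most `32π/N² ≤ 32π/N ≤ ε/2`.
  obtain ⟨N, hN⟩ := exists_nat_gt (max 1 (64 * Real.pi / ε))
  have hN1 : (1 : ℝ) < N := (le_max_left _ _).trans_lt hN
  have hN2 : 64 * Real.pi / ε < N := (le_max_right _ _).trans_lt hN
  have hN0 : 0 < N := by exact_mod_cast one_pos.trans hN1
  refine ⟨2 * L * N, by positivity, fun r hr c => ?_⟩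
  set S : Set S2 := {σ | ‖c + r • (σ : R3)‖ < L} with hS
  have hSm : MeasurableSet S := measurableSet_lt (by fun_prop) measurable_const
  have hr0 : 0 < |r| := lt_of_lt_of_le (by positivity) hr
  have hSμ : (volume : Measure R3).toSphere S ≤ ENNReal.ofReal (ε / 2) := by
    rcases S.eq_empty_or_nonempty with h | ⟨σ₀, hσ₀⟩
    · simp [h]
    · refine (measure_mono ?_).trans ((toSphere_cap_le σ₀ hN0).trans
        (ENNReal.ofReal_le_ofReal ?_))
      · intro σ hσ
        have e : r • ((σ : R3) - σ₀) = (c + r • (σ : R3)) - (c + r • (σ₀ : R3)) := by module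
        have h1 : |r| * ‖(σ : R3) - σ₀‖ ≤ 2 * L := by
          rw [← Real.norm_eq_abs, ← norm_smul, e]
          refine (norm_sub_le _ _).trans ?_
          have h2 : ‖c + r • (σ : R3)‖ < L := hσ
          have h3 : ‖c + r • (σ₀ : R3)‖ < L := hσ₀
          linarith
        show ‖(σ : R3) - σ₀‖ ≤ 1 / N
        rw [le_div_iff₀ (by positivity)]
        have h4 : 2 * L * N * ‖(σ : R3) - σ₀‖ ≤ 2 * L :=
          (mul_le_mul_of_nonneg_right hr (norm_nonneg _)).trans h1
        nlinarith
      · rw [div_lt_iff₀ hε] at hN2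
        rw [div_le_iff₀ (by positivity)]
        nlinarith [Real.pi_pos]
  calc ∫⁻ σ : S2, ENNReal.ofReal (bracket (β • (c + r • (σ : R3))) ^ (-q))
        ∂(volume : Measure R3).toSphere
      ≤ ∫⁻ σ : S2, (S.indicator 1 σ + ENNReal.ofReal (ε / (8 * Real.pi)))
        ∂(volume : Measure R3).toSphere := by
        refine lintegral_mono fun σ => ?_
        by_cases hσ : σ ∈ S
        · rw [indicator_of_mem hσ]
          exact le_add_right (by
            simpa using ENNReal.ofReal_le_ofReal (bracket_rpow_neg_le_one _ hq.le))
        · rw [indicator_of_notMem hσ, zero_add]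
          exact ENNReal.ofReal_le_ofReal (hL _ (not_lt.1 hσ))
    _ = (volume : Measure R3).toSphere S + ENNReal.ofReal (ε / 2) := by
        rw [lintegral_add_right _ measurable_const, lintegral_indicator_one hSm, lintegral_const,
          toSphere_univ_eq, ← ENNReal.ofReal_mul hη.le]
        congr 2; field_simp; ring
    _ ≤ ENNReal.ofReal (ε / 2) + ENNReal.ofReal (ε / 2) := by gcongr
    _ = ENNReal.ofReal ε := by
        rw [← ENNReal.ofReal_add (by positivity) (by positivity)]; congr 1; ring

end Sphere

/-! ### Continuity of the explicit functions. -/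

section Continuity

variable {X : Type*} [TopologicalSpace X]

@[fun_prop]
lemma continuous_vel2_comp {f g : X → R3} {h : X → S2} (hf : Continuous f) (hg : Continuous g)
    (hh : Continuous h) : Continuous fun x => vel2 (f x) (g x) (h x) := by
  unfold vel2; fun_prop

@[fun_prop]
lemma continuous_vel3_comp {f g : X → R3} {h : X → S2} (hf : Continuous f) (hg : Continuous g)
    (hh : Continuous h) : Continuous fun x => vel3 (f x) (g x) (h x) := by
  unfold vel3; fun_prop

@[fun_prop]
lemma continuous_along_comp {s : X → ℝ} {f : X → R3 × R3} {g : X → R3} (hs : Continuous s)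
    (hf : Continuous f) (hg : Continuous g) : Continuous fun x => along (s x) (f x) (g x) := by
  unfold along; fun_prop

lemma continuous_bracket_rpow_comp {f : X → R3} (hf : Continuous f) (r : ℝ) :
    Continuous fun x => bracket (f x) ^ r :=
  Continuous.rpow_const (by fun_prop) fun _ => Or.inl (bracket_pos _).ne'

@[fun_prop]
lemma continuous_velGain_comp {q β : ℝ} {f g : X → R3} {h : X → S2} (hf : Continuous f)
    (hg : Continuous g) (hh : Continuous h) :
    Continuous fun x => velGain q β (f x) (g x) (h x) := by
  unfold velGain
  exact (continuous_bracket_rpow_comp (by fun_prop) _).add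
    (continuous_bracket_rpow_comp (by fun_prop) _)

@[fun_prop]
lemma continuous_tripleSum_comp {p q α β : ℝ} {s : X → ℝ} {f : X → R3 × R3} {a : X → R3 × S2}
    (hs : Continuous s) (hf : Continuous f) (ha : Continuous a) :
    Continuous fun x => tripleSum p q α β (s x) (f x) (a x) := by
  unfold tripleSum
  fun_prop

end Continuity

/-! ### Space-time bounds for the collision majorant. -/

noncomputable section

/-- The majorant of the collision integrand, with the collision kernel. -/
def kern (p q α β : ℝ) (s : ℝ) (z : R3 × R3) (a : R3 × S2) : ℝ :=
  ‖z.2 - a.1‖ / 8 * tripleSum p q α β s z a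

end

lemma kern_nonneg (s : ℝ) (z : R3 × R3) (a : R3 × S2) : 0 ≤ kern p q α β s z a :=
  mul_nonneg (by positivity) (tripleSum_pos s z a).le

@[fun_prop]
lemma continuous_kern_comp {X : Type*} [TopologicalSpace X] {s : X → ℝ} {f : X → R3 × R3}
    {a : X → R3 × S2} (hs : Continuous s) (hf : Continuous f) (ha : Continuous a) :
    Continuous fun x => kern p q α β (s x) (f x) (a x) := by
  unfold kern
  fun_prop

lemma inv_pow_three_le_max (hβ : 0 < β) (hq : 3 < q) :
    (β ^ 3)⁻¹ ≤ max (β ^ q) (β ^ (-(3 * q))) := by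
  rcases le_total β 1 with h | h
  · refine le_max_of_le_right ?_
    rw [← Real.rpow_natCast, ← Real.rpow_neg hβ.le]
    refine Real.rpow_le_rpow_of_exponent_ge hβ h ?_
    push_cast; linarith
  · refine le_max_of_le_left ?_
    exact (inv_le_one_of_one_le₀ (one_le_pow₀ h)).trans (Real.one_le_rpow h (by linarith))

lemma constC_pos (hp : 1 < p) (hq : 3 < q) (hα : 0 < α) (hβ : 0 < β) : 0 < constC p q α β := by
  have h1 : 0 < p - 1 := by linarith
  have h2 : 0 < q - 3 := by linarith
  have h3 : 0 < max (β ^ q) (β ^ (-(3 * q))) := lt_max_of_lt_left (by positivity)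
  have h4 : 0 < p := by linarith
  unfold constC
  positivity

/-- The factors on the left are the four triple products times the kernel factor `1/8`, the line
integral, the area of the sphere and the velocity integral. The stated constant is larger, since `π²
≤ π³` and `β⁻³` is at most the maximum. -/
lemma le_constC (hp : 1 < p) (hq : 3 < q) (hα : 0 < α) (hβ : 0 < β) :
    1 / 2 * (2 * p / (α * (p - 1))) * (4 * Real.pi) *
      (4 * Real.pi * (β ^ 3)⁻¹ * (1 / 3 + 1 / (q - 3))) ≤ constC p q α β := by
  have h1 : 0 < p - 1 := by linarith
  have h2 : 0 < q - 3 := by linarith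
  have h4 : 0 < p := by linarith
  have h3 := inv_pow_three_le_max hβ hq
  have hpi : (1 : ℝ) ≤ Real.pi := by linarith [Real.pi_gt_three]
  have hpi2 : Real.pi ^ 2 ≤ Real.pi ^ 3 := pow_le_pow_right₀ hpi (by norm_num)
  unfold constC
  calc _ = (16 * p * Real.pi ^ 2 / (α * (p - 1)) * (1 / 3 + 1 / (q - 3))) * (β ^ 3)⁻¹ := by
        field_simp; ring
    _ ≤ _ := by gcongr

/-- Time is integrated first, for fixed `(v₁, σ)`: by `tripleSum_le` the position factor at `v₁`
decays along a line of direction `v - v₁`, which absorbs the kernel. The weight at `z` comes out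
unchanged, and this closes the estimate. -/
lemma lintegral_kern_le (hp : 1 < p) (hq : 3 < q) (hα : 0 < α) (hβ : 0 < β) (z : R3 × R3) :
    ∫⁻ y : ℝ × (R3 × S2), ENNReal.ofReal (kern p q α β y.1 z y.2)
        ∂((volume : Measure ℝ).prod paramMeasure) ≤
      ENNReal.ofReal (constC p q α β * wt p q α β z) := by
  have hz := (wt_pos (p := p) (q := q) (α := α) (β := β) z).le
  have hm : Continuous fun y : ℝ × (R3 × S2) => kern p q α β y.1 z y.2 := by fun_prop
  rw [lintegral_prod_symm _ hm.measurable.ennreal_ofReal.aemeasurable]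
  have h1 : ∀ a : R3 × S2, ∫⁻ s : ℝ, ENNReal.ofReal (kern p q α β s z a) ≤
      ENNReal.ofReal (1 / 2 * wt p q α β z * (2 * p / (α * (p - 1)))) *
        ENNReal.ofReal (bracket (β • a.1) ^ (-q)) := fun a => by
    have hb := (bracket_rpow_neg_pos (β • a.1) (-q)).le
    have hle : ∀ s : ℝ, ENNReal.ofReal (kern p q α β s z a) ≤
        ENNReal.ofReal (1 / 2 * wt p q α β z * bracket (β • a.1) ^ (-q)) *
          ENNReal.ofReal (‖z.2 - a.1‖ * bracket (α • (z.1 + s • (z.2 - a.1))) ^ (-p)) := fun s => by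
      rw [← ENNReal.ofReal_mul (by positivity)]
      refine ENNReal.ofReal_le_ofReal ?_
      refine (mul_le_mul_of_nonneg_left (tripleSum_le (by linarith) (by linarith) s z a)
        (by positivity)).trans_eq ?_
      rw [wt, wt, along]
      ring
    have hc : Measurable fun s : ℝ => ENNReal.ofReal
        (‖z.2 - a.1‖ * bracket (α • (z.1 + s • (z.2 - a.1))) ^ (-p)) :=
      (continuous_const.mul
        (continuous_bracket_rpow_comp (by fun_prop) _)).measurable.ennreal_ofReal
    refine (lintegral_mono hle).trans ?_
    rw [lintegral_const_mul _ hc]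
    refine (mul_le_mul_right (lintegral_bracket_line_le hα hp z.1 (z.2 - a.1)) _).trans_eq ?_
    rw [← ENNReal.ofReal_mul (by positivity), ← ENNReal.ofReal_mul ?_]
    · congr 1; ring
    · have : 0 < p - 1 := by linarith
      positivity
  refine (lintegral_mono h1).trans ?_
  have hbm : Measurable fun v : R3 => ENNReal.ofReal (bracket (β • v) ^ (-q)) :=
    (continuous_bracket_rpow_comp (by fun_prop) _).measurable.ennreal_ofReal
  have hbm' : Measurable fun a : R3 × S2 => ENNReal.ofReal (bracket (β • a.1) ^ (-q)) :=
    hbm.comp measurable_fst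
  rw [lintegral_const_mul _ hbm', paramMeasure, lintegral_prod _ hbm'.aemeasurable]
  simp only [lintegral_const, toSphere_univ_eq]
  rw [lintegral_mul_const _ hbm]
  have h1 : 0 < p - 1 := by linarith
  have h2 : 0 < q - 3 := by linarith
  have h4 : 0 < p := by linarith
  refine (mul_le_mul_right (mul_le_mul_left (lintegral_bracket_velocity_le hβ hq) _) _).trans ?_
  rw [← ENNReal.ofReal_mul (by positivity), ← ENNReal.ofReal_mul (by positivity)]
  refine ENNReal.ofReal_le_ofReal ?_
  refine le_of_eq_of_le ?_ (mul_le_mul_of_nonneg_right (le_constC hp hq hα hβ) hz)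
  ring

lemma lintegral_velGain_le (hq : 0 ≤ q) (v v₁ : R3) :
    ∫⁻ σ : S2, ENNReal.ofReal (velGain q β v v₁ σ) ∂(volume : Measure R3).toSphere ≤
      ENNReal.ofReal (8 * Real.pi) := by
  have : ∀ σ : S2, ENNReal.ofReal (velGain q β v v₁ σ) ≤ ENNReal.ofReal 2 := fun σ => by
    refine ENNReal.ofReal_le_ofReal ?_
    have := add_le_add (bracket_rpow_neg_le_one (β • vel2 v v₁ σ) hq)
      (bracket_rpow_neg_le_one (β • vel3 v v₁ σ) hq)
    unfold velGain
    linarith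
  refine (lintegral_mono this).trans_eq ?_
  rw [lintegral_const, toSphere_univ_eq, ← ENNReal.ofReal_mul (by norm_num)]
  congr 1; ring

lemma exists_lintegral_velGain_le (hβ : 0 < β) (hq : 0 < q) {ε : ℝ} (hε : 0 < ε) :
    ∃ R : ℝ, 0 < R ∧ ∀ v v₁ : R3, R ≤ ‖v - v₁‖ →
      ∫⁻ σ : S2, ENNReal.ofReal (velGain q β v v₁ σ) ∂(volume : Measure R3).toSphere ≤
        ENNReal.ofReal ε := by
  obtain ⟨R, hR, h⟩ := exists_forall_lintegral_sphere_bracket_le hβ hq (half_pos hε)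
  refine ⟨2 * R, by positivity, fun v v₁ hv => ?_⟩
  have hr : R ≤ |‖v - v₁‖ / 2| := by
    rw [abs_of_nonneg (by positivity)]; linarith
  have h2 := h (‖v - v₁‖ / 2) hr ((2 : ℝ)⁻¹ • (v + v₁))
  have h3 := h (-(‖v - v₁‖ / 2)) (by rwa [abs_neg]) ((2 : ℝ)⁻¹ • (v + v₁))
  have hm : Measurable fun σ : S2 => ENNReal.ofReal (bracket (β • vel2 v v₁ σ) ^ (-q)) :=
    (continuous_bracket_rpow_comp (by fun_prop) _).measurable.ennreal_ofReal
  have e : ∀ σ : S2, ENNReal.ofReal (velGain q β v v₁ σ) =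
      ENNReal.ofReal (bracket (β • vel2 v v₁ σ) ^ (-q)) +
        ENNReal.ofReal (bracket (β • vel3 v v₁ σ) ^ (-q)) := fun σ => by
    rw [velGain, ENNReal.ofReal_add (bracket_rpow_neg_pos _ _).le (bracket_rpow_neg_pos _ _).le]
  simp_rw [e]
  rw [lintegral_add_left hm]
  refine (add_le_add h2 (le_of_eq_of_le ?_ h3)).trans_eq ?_
  · simp only [vel3, neg_smul, sub_eq_add_neg]
  · rw [← ENNReal.ofReal_add (by positivity) (by positivity)]; congr 1; ring

/-- Absolute continuity of the time integral, uniform in `z` relative to the weight. A short time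
set does not by itself help when `|v - v₁|` is large, hence the factor `velGain`. -/
lemma exists_setLIntegral_kern_le (hp : 1 < p) (hq : 3 < q) (hα : 0 < α) (hβ : 0 < β) {ε : ℝ}
    (hε : 0 < ε) : ∃ δ : ℝ, 0 < δ ∧ ∀ I : Set ℝ, volume I ≤ ENNReal.ofReal δ → ∀ z : R3 × R3,
      ∫⁻ y : ℝ × (R3 × S2), ENNReal.ofReal (kern p q α β y.1 z y.2)
          ∂((volume.restrict I).prod paramMeasure) ≤ ENNReal.ofReal (ε * wt p q α β z) := by
  have h1 : 0 < p - 1 := by linarith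
  have h2 : 0 < q - 3 := by linarith
  have h4 : 0 < p := by linarith
  set K : ℝ := 3 * 2 ^ (q / 2) / 8 with hK
  set J : ℝ := 4 * Real.pi * (β ^ 3)⁻¹ * (1 / 3 + 1 / (q - 3)) with hJ
  set c : ℝ := 2 * p / (α * (p - 1)) with hc
  have hK0 : 0 < K := by positivity
  have hJ0 : 0 < J := by positivity
  have hc0 : 0 < c := by positivity
  set ε₁ : ℝ := ε / (K * J) with hε₁
  have hε₁0 : 0 < ε₁ := by positivity
  obtain ⟨R, hR, hgain⟩ := exists_lintegral_velGain_le (q := q) hβ (by linarith)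
    (div_pos hε₁0 hc0)
  refine ⟨ε₁ / (R * (8 * Real.pi)), by positivity, fun I hI z => ?_⟩
  have hz := (wt_pos (p := p) (q := q) (α := α) (β := β) z).le
  have hm : Continuous fun y : ℝ × (R3 × S2) => kern p q α β y.1 z y.2 := by fun_prop
  rw [lintegral_prod_symm _ hm.measurable.ennreal_ofReal.aemeasurable]
  set T : R3 → ℝ≥0∞ := fun v₁ => ∫⁻ s in I, ENNReal.ofReal
    (‖z.2 - v₁‖ * bracket (α • (z.1 + s • (z.2 - v₁))) ^ (-p)) with hT
  have hTc : Continuous fun y : R3 × ℝ =>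
      ‖z.2 - y.1‖ * bracket (α • (z.1 + y.2 • (z.2 - y.1))) ^ (-p) :=
    Continuous.mul (by fun_prop) (continuous_bracket_rpow_comp (by fun_prop) _)
  have hTm : Measurable T := hTc.measurable.ennreal_ofReal.lintegral_prod_right'
  have hb : Measurable fun v : R3 => ENNReal.ofReal (K * wt p q α β z * bracket (β • v) ^ (-q)) :=
    (continuous_const.mul
      (continuous_bracket_rpow_comp (by fun_prop) _)).measurable.ennreal_ofReal
  have hg : Continuous fun a : R3 × S2 => velGain q β z.2 a.1 a.2 := by fun_prop
  have hin : ∀ a : R3 × S2, ∫⁻ s in I, ENNReal.ofReal (kern p q α β s z a) ≤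
      ENNReal.ofReal (K * wt p q α β z * bracket (β • a.1) ^ (-q)) *
        ENNReal.ofReal (velGain q β z.2 a.1 a.2) * T a.1 := fun a => by
    have hb' := (bracket_rpow_neg_pos (β • a.1) (-q)).le
    have hv := (velGain_pos (q := q) (β := β) z.2 a.1 a.2).le
    have hTs : Measurable fun s : ℝ => ENNReal.ofReal
        (‖z.2 - a.1‖ * bracket (α • (z.1 + s • (z.2 - a.1))) ^ (-p)) :=
      (hTc.comp (by fun_prop : Continuous fun s : ℝ => (a.1, s))).measurable.ennreal_ofReal
    simp only [hT]
    rw [← lintegral_const_mul _ hTs]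
    refine lintegral_mono fun s => ?_
    rw [← ENNReal.ofReal_mul (by positivity), ← ENNReal.ofReal_mul (by positivity)]
    refine ENNReal.ofReal_le_ofReal ?_
    refine (mul_le_mul_of_nonneg_left (tripleSum_le_gain (by linarith) (by linarith) s z a)
      (by positivity)).trans_eq ?_
    simp only [wt, along, hK]
    ring
  -- For `|v - v₁| ≥ R` the spherical average is small and the line integral bounded; for `|v - v₁|
  -- ≤ R` the average is bounded and the time integral is at most `R` times the measure of `I`.
  have hprod : ∀ v₁ : R3, (∫⁻ σ : S2, ENNReal.ofReal (velGain q β z.2 v₁ σ)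
      ∂(volume : Measure R3).toSphere) * T v₁ ≤ ENNReal.ofReal ε₁ := fun v₁ => by
    rcases le_total R ‖z.2 - v₁‖ with h | h
    · refine (mul_le_mul' (hgain _ _ h) ((setLIntegral_le_lintegral I _).trans
        (lintegral_bracket_line_le hα hp z.1 (z.2 - v₁)))).trans_eq ?_
      rw [← ENNReal.ofReal_mul (by positivity)]
      congr 1
      rw [← hc]; field_simp
    · have hTle : T v₁ ≤ ENNReal.ofReal (R * (ε₁ / (R * (8 * Real.pi)))) := by
        calc T v₁ ≤ ∫⁻ s in I, ENNReal.ofReal R := by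
              refine lintegral_mono fun s => ENNReal.ofReal_le_ofReal ?_
              exact (mul_le_of_le_one_right (norm_nonneg _)
                (bracket_rpow_neg_le_one _ h4.le)).trans h
          _ ≤ _ := by
              rw [lintegral_const, Measure.restrict_apply_univ, ENNReal.ofReal_mul hR.le]
              gcongr
      refine (mul_le_mul' (lintegral_velGain_le (by linarith) _ _) hTle).trans_eq ?_
      rw [← ENNReal.ofReal_mul (by positivity)]
      congr 1
      field_simp
  calc _ ≤ ∫⁻ a : R3 × S2, ENNReal.ofReal (K * wt p q α β z * bracket (β • a.1) ^ (-q)) *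
        ENNReal.ofReal (velGain q β z.2 a.1 a.2) * T a.1 ∂paramMeasure := lintegral_mono hin
    _ = ∫⁻ v₁ : R3, ENNReal.ofReal (K * wt p q α β z * bracket (β • v₁) ^ (-q)) *
        ((∫⁻ σ : S2, ENNReal.ofReal (velGain q β z.2 v₁ σ)
          ∂(volume : Measure R3).toSphere) * T v₁) := by
        rw [paramMeasure, lintegral_prod]
        · refine lintegral_congr fun v₁ => ?_
          have hgs : Measurable fun σ : S2 => ENNReal.ofReal (velGain q β z.2 v₁ σ) :=
            (by fun_prop : Continuous fun σ : S2 => velGain q β z.2 v₁ σ).measurable.ennreal_ofReal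
          dsimp only
          rw [lintegral_mul_const _ (hgs.const_mul _), lintegral_const_mul _ hgs, mul_assoc]
        · exact (((hb.comp measurable_fst).mul hg.measurable.ennreal_ofReal).mul
            (hTm.comp measurable_fst)).aemeasurable
    _ ≤ ∫⁻ v₁ : R3, ENNReal.ofReal (K * wt p q α β z) *
          ENNReal.ofReal (bracket (β • v₁) ^ (-q)) * ENNReal.ofReal ε₁ := by
        refine lintegral_mono fun v₁ => ?_
        rw [← ENNReal.ofReal_mul (by positivity)]
        exact mul_le_mul_right (hprod v₁) _
    _ ≤ ENNReal.ofReal (K * wt p q α β z) * ENNReal.ofReal J * ENNReal.ofReal ε₁ := by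
        have hbm : Measurable fun v : R3 => ENNReal.ofReal (bracket (β • v) ^ (-q)) :=
          (continuous_bracket_rpow_comp (by fun_prop) _).measurable.ennreal_ofReal
        rw [lintegral_mul_const _ (hbm.const_mul _), lintegral_const_mul _ hbm]
        exact mul_le_mul_left (mul_le_mul_right (lintegral_bracket_velocity_le hβ hq) _) _
    _ = _ := by
        rw [← ENNReal.ofReal_mul (by positivity), ← ENNReal.ofReal_mul (by positivity)]
        congr 1
        rw [hε₁]; field_simp

/-! ### Measure-preserving rearrangements and shears. -/

section Product

variable {A B C : Type*} [MeasurableSpace A] [MeasurableSpace B] [MeasurableSpace C]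

lemma measurePreserving_leftComm (μ : Measure A) (ν : Measure B) (τ : Measure C) [SFinite μ]
    [SFinite ν] [SFinite τ] :
    MeasurePreserving (fun y : A × (B × C) => (y.2.1, (y.1, y.2.2))) (μ.prod (ν.prod τ))
      (ν.prod (μ.prod τ)) := by
  have h0 : MeasurePreserving MeasurableEquiv.prodAssoc ((μ.prod ν).prod τ) (μ.prod (ν.prod τ)) :=
    ⟨MeasurableEquiv.measurable _, Measure.prodAssoc_prod⟩
  have h3 : MeasurePreserving MeasurableEquiv.prodAssoc ((ν.prod μ).prod τ) (ν.prod (μ.prod τ)) :=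
    ⟨MeasurableEquiv.measurable _, Measure.prodAssoc_prod⟩
  have h2 := (Measure.measurePreserving_swap (μ := μ) (ν := ν)).prod (MeasurePreserving.id τ)
  exact (h3.comp h2).comp h0.symm

lemma measurePreserving_shear {G : Type*} [AddGroup G] [MeasurableSpace G] [MeasurableAdd₂ G]
    (μ : Measure G) [SFinite μ] [μ.IsAddRightInvariant] (ν : Measure A) [SFinite ν] {g : A → G}
    (hg : Measurable g) :
    MeasurePreserving (fun y : G × A => (y.1 + g y.2, y.2)) (μ.prod ν) (μ.prod ν) := by
  have h : MeasurePreserving (fun y : A × G => (y.1, y.2 + g y.1)) (ν.prod μ) (ν.prod μ) :=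
    (MeasurePreserving.id ν).skew_product (g := fun a x => x + g a)
      (measurable_snd.add (hg.comp measurable_fst))
      (Eventually.of_forall fun a => map_add_right_eq_self μ (g a))
  exact (Measure.measurePreserving_swap.comp h).comp Measure.measurePreserving_swap

end Product

/-! ### Polar coordinates. -/

section Polar

noncomputable section

/-- The direction of a vector, with an arbitrary value at `0`. -/
def direction (u : R3) : S2 :=
  ⟨if u = 0 then EuclideanSpace.single 0 1 else ‖u‖⁻¹ • u, by
    split_ifs with h
    · simp
    · simp [norm_smul, h]⟩

end

lemma measurable_direction : Measurable direction :=
  Measurable.subtype_mk <| Measurable.ite (measurableSet_singleton 0) measurable_const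
    (measurable_norm.inv.smul measurable_id)

lemma norm_smul_direction (u : R3) : ‖u‖ • (direction u : R3) = u := by
  unfold direction
  by_cases h : u = 0
  · simp [h]
  · simp [h, smul_smul]

lemma direction_smul (σ : S2) {r : ℝ} (hr : 0 < r) : direction (r • (σ : R3)) = σ := by
  have hσ : (σ : R3) ≠ 0 := ne_zero_of_mem_unit_sphere σ
  ext1
  unfold direction
  simp [hr.ne', hσ, norm_smul, smul_smul, abs_of_pos hr]

lemma measurePreserving_polar :
    MeasurePreserving (fun y : S2 × Ioi (0 : ℝ) => (y.2 : ℝ) • (y.1 : R3))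
      ((volume : Measure R3).toSphere.prod (Measure.volumeIoiPow 2)) volume := by
  have h := (volume : Measure R3).measurePreserving_homeomorphUnitSphereProd
  have hd : Module.finrank ℝ R3 - 1 = 2 := by simp
  rw [hd] at h
  have h1 := MeasurePreserving.symm (homeomorphUnitSphereProd R3).toMeasurableEquiv h
  have h2 := measurePreserving_subtype_coe (μa := (volume : Measure R3)) (s := {0}ᶜ)
    (measurableSet_singleton 0).compl
  rw [restrict_compl_singleton] at h2
  exact h2.comp h1

end Polar

/-! ### Invariance of the measure under collisions. -/

section CollisionMap

/-- The map from the parameters `(v, v₁, σ)` of a collision to those of the reverse collision. -/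
noncomputable def collisionMap (y : R3 × (R3 × S2)) : R3 × (R3 × S2) :=
  (vel2 y.1 y.2.1 y.2.2, (vel3 y.1 y.2.1 y.2.2, direction (y.1 - y.2.1)))

lemma measurable_collisionMap : Measurable collisionMap := by
  have h2 : Continuous fun y : R3 × (R3 × S2) => vel2 y.1 y.2.1 y.2.2 := by fun_prop
  have h3 : Continuous fun y : R3 × (R3 × S2) => vel3 y.1 y.2.1 y.2.2 := by fun_prop
  exact h2.measurable.prodMk (h3.measurable.prodMk (measurable_direction.comp (by fun_prop)))

/-- Coordinates in which the collision map exchanges two directions: the velocity of the centre of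
mass, and the polar coordinates of the relative velocity before and after the collision. -/
noncomputable def centerCoord (y : R3 × ((S2 × Ioi (0 : ℝ)) × S2)) : R3 × (R3 × S2) :=
  (y.1 + (2 : ℝ)⁻¹ • ((y.2.1.2 : ℝ) • (y.2.1.1 : R3)),
    (y.1 - (2 : ℝ)⁻¹ • ((y.2.1.2 : ℝ) • (y.2.1.1 : R3)), y.2.2))

instance : SFinite (Measure.volumeIoiPow 2) := inferInstance

instance : SFinite ((volume : Measure R3).toSphere.prod (Measure.volumeIoiPow 2)) :=
  inferInstance

/-- With `u = v - v₁` in polar form, the map is a composition of `(V, u) ↦ (V + u/2, u)` and `(v, u)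
↦ (v, v - u)`, both of which preserve Lebesgue measure. -/
lemma measurePreserving_centerCoord :
    MeasurePreserving centerCoord
      ((volume : Measure R3).prod (((volume : Measure R3).toSphere.prod
        (Measure.volumeIoiPow 2)).prod (volume : Measure R3).toSphere))
      ((volume : Measure R3).prod paramMeasure) := by
  have h1 := (MeasurePreserving.id (volume : Measure R3)).prod
    (measurePreserving_polar.prod (MeasurePreserving.id (volume : Measure R3).toSphere))
  have h2 := measurePreserving_shear (volume : Measure R3)
    ((volume : Measure R3).prod (volume : Measure R3).toSphere)
    (g := fun a => (2 : ℝ)⁻¹ • a.1) (by fun_prop)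
  have h3 : MeasurePreserving (fun y : R3 × (R3 × S2) => (y.1, (y.1 - y.2.1, y.2.2)))
      ((volume : Measure R3).prod paramMeasure) ((volume : Measure R3).prod paramMeasure) :=
    (MeasurePreserving.id _).skew_product (g := fun (v : R3) (a : R3 × S2) => (v - a.1, a.2))
      (by fun_prop) (Eventually.of_forall fun v =>
        ((Measure.measurePreserving_sub_left (volume : Measure R3) v).prod
          (MeasurePreserving.id (volume : Measure R3).toSphere)).map_eq)
  have h := (h3.comp h2).comp h1
  convert h using 1
  funext y
  simp only [Function.comp_apply, Prod.map, id, centerCoord, Prod.mk.injEq, and_true, true_and]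
  module

/-- The centre of mass and the relative speed are conserved, so the collision only exchanges the
direction of `v - v₁` with `σ`. -/
lemma collisionMap_centerCoord (y : R3 × ((S2 × Ioi (0 : ℝ)) × S2)) :
    collisionMap (centerCoord y) = centerCoord (y.1, ((y.2.2, y.2.1.2), y.2.1.1)) := by
  obtain ⟨V, ⟨ω, r, hr⟩, σ⟩ := y
  have hr' : 0 < r := hr
  have hd : V + (2 : ℝ)⁻¹ • (r • (ω : R3)) - (V - (2 : ℝ)⁻¹ • (r • (ω : R3))) = r • (ω : R3) := by
    module
  have hn : ‖r • (ω : R3)‖ = r := by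
    rw [norm_smul, norm_eq_of_mem_sphere, mul_one, Real.norm_of_nonneg hr'.le]
  simp only [collisionMap, centerCoord, vel2, vel3, hd, hn, direction_smul ω hr', Prod.mk.injEq,
    and_true]
  constructor <;> module

lemma measurePreserving_collisionMap :
    MeasurePreserving collisionMap ((volume : Measure R3).prod paramMeasure)
      ((volume : Measure R3).prod paramMeasure) := by
  have h1 : MeasurePreserving
      (fun y : (S2 × Ioi (0 : ℝ)) × S2 => (((y.2, y.1.2), y.1.1) : (S2 × Ioi (0 : ℝ)) × S2))
      (((volume : Measure R3).toSphere.prod (Measure.volumeIoiPow 2)).prod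
        (volume : Measure R3).toSphere)
      (((volume : Measure R3).toSphere.prod (Measure.volumeIoiPow 2)).prod
        (volume : Measure R3).toSphere) := by
    have ha := Measure.measurePreserving_swap (μ := (volume : Measure R3).toSphere.prod
      (Measure.volumeIoiPow 2)) (ν := (volume : Measure R3).toSphere)
    have hb := measurePreserving_leftComm (volume : Measure R3).toSphere
      (volume : Measure R3).toSphere (Measure.volumeIoiPow 2)
    have hc := Measure.measurePreserving_swap (μ := (volume : Measure R3).toSphere)
      (ν := (volume : Measure R3).toSphere.prod (Measure.volumeIoiPow 2))
    exact (hc.comp hb).comp ha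
  -- Invariance under the exchange of the two directions descends along `centerCoord`.
  exact measurePreserving_centerCoord.of_semiconj ((MeasurePreserving.id _).prod h1)
    (fun y => (collisionMap_centerCoord y).symm) measurable_collisionMap

lemma vel2_collisionMap (y : R3 × (R3 × S2)) :
    vel2 (collisionMap y).1 (collisionMap y).2.1 (collisionMap y).2.2 = y.1 := by
  simp only [collisionMap]
  rw [vel2, vel2_add_vel3, norm_vel2_sub_vel3, div_eq_mul_inv, mul_comm, ← smul_smul,
    norm_smul_direction]
  module

lemma vel3_collisionMap (y : R3 × (R3 × S2)) :
    vel3 (collisionMap y).1 (collisionMap y).2.1 (collisionMap y).2.2 = y.2.1 := by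
  simp only [collisionMap]
  rw [vel3, vel2_add_vel3, norm_vel2_sub_vel3, div_eq_mul_inv, mul_comm, ← smul_smul,
    norm_smul_direction]
  module

lemma vel2_comm (v v₁ : R3) (σ : S2) : vel2 v₁ v σ = vel2 v v₁ σ := by
  rw [vel2, vel2, add_comm v₁, norm_sub_rev]

lemma vel3_comm (v v₁ : R3) (σ : S2) : vel3 v₁ v σ = vel3 v v₁ σ := by
  rw [vel3, vel3, add_comm v₁, norm_sub_rev]

/-- `vel2` is the first component of the measure-preserving `collisionMap`, so null sets of
velocities pull back to null sets of collisions. -/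
lemma quasiMeasurePreserving_vel2 :
    Measure.QuasiMeasurePreserving (fun y : R3 × (R3 × S2) => vel2 y.1 y.2.1 y.2.2)
      ((volume : Measure R3).prod paramMeasure) volume :=
  Measure.quasiMeasurePreserving_fst.comp measurePreserving_collisionMap.quasiMeasurePreserving

lemma quasiMeasurePreserving_fst_param :
    Measure.QuasiMeasurePreserving (fun y : R3 × (R3 × S2) => y.2.1)
      ((volume : Measure R3).prod paramMeasure) volume :=
  Measure.quasiMeasurePreserving_fst.comp Measure.quasiMeasurePreserving_snd

lemma quasiMeasurePreserving_vel3 :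
    Measure.QuasiMeasurePreserving (fun y : R3 × (R3 × S2) => vel3 y.1 y.2.1 y.2.2)
      ((volume : Measure R3).prod paramMeasure) volume :=
  quasiMeasurePreserving_fst_param.comp measurePreserving_collisionMap.quasiMeasurePreserving

end CollisionMap

/-! ### Null sets and free transport. -/

section Trajectories

variable {A : Type*} [MeasurableSpace A]

/-- For fixed `(v, s, a)` the position is merely translated, and the velocity is handled by the
hypothesis on `W`. It will be used with `W` each of the four velocities of a collision. -/
lemma quasiMeasurePreserving_along (μ : Measure ℝ) [SFinite μ] (ν : Measure A) [SFinite ν]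
    {W : R3 × A → R3}
    (hW : Measure.QuasiMeasurePreserving W ((volume : Measure R3).prod ν) volume) :
    Measure.QuasiMeasurePreserving
      (fun y : (R3 × R3) × (ℝ × A) => (y.2.1, along y.2.1 y.1 (W (y.1.2, y.2.2))))
      ((volume : Measure (R3 × R3)).prod (μ.prod ν)) (μ.prod (volume : Measure (R3 × R3))) := by
  have h0 : MeasurePreserving MeasurableEquiv.prodAssoc
      (((volume : Measure R3).prod (volume : Measure R3)).prod (μ.prod ν))
      ((volume : Measure R3).prod ((volume : Measure R3).prod (μ.prod ν))) :=
    ⟨MeasurableEquiv.measurable _, Measure.prodAssoc_prod⟩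
  have hWm := hW.measurable
  have h1 := measurePreserving_shear (volume : Measure R3)
    ((volume : Measure R3).prod (μ.prod ν))
    (g := fun y => y.2.1 • (y.1 - W (y.1, y.2.2))) (by fun_prop)
  have h2 := (measurePreserving_leftComm (volume : Measure R3) μ ν).quasiMeasurePreserving
  have h3 := MeasureTheory.QuasiMeasurePreserving.prodMap (Measure.QuasiMeasurePreserving.id μ) hW
  have h4 := MeasureTheory.QuasiMeasurePreserving.prodMap
    (Measure.QuasiMeasurePreserving.id (volume : Measure R3)) (h3.comp h2)
  have h5 := (measurePreserving_leftComm (volume : Measure R3) μ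
    (volume : Measure R3)).quasiMeasurePreserving
  exact (h5.comp h4).comp (h1.comp h0).quasiMeasurePreserving

lemma measurePreserving_transport (t : ℝ) :
    MeasurePreserving (fun z : R3 × R3 => (z.1 + t • z.2, z.2)) volume volume :=
  measurePreserving_shear (volume : Measure R3) (volume : Measure R3) (g := fun v => t • v)
    (by fun_prop)

lemma measurePreserving_transport_time (μ : Measure ℝ) [SFinite μ] :
    MeasurePreserving (fun y : ℝ × (R3 × R3) => (y.1, (y.2.1 + y.1 • y.2.2, y.2.2)))
      (μ.prod volume) (μ.prod volume) :=
  (MeasurePreserving.id μ).skew_product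
    (g := fun (t : ℝ) (z : R3 × R3) => (z.1 + t • z.2, z.2)) (by fun_prop)
    (Eventually.of_forall fun t => (measurePreserving_transport t).map_eq)

end Trajectories

/-! ### The equation along the free flow. -/

noncomputable section

/-- The algebraic part `f₁ f₂ f₃ + f f₂ f₃ - f f₁ f₃ - f f₁ f₂` of the collision operator. -/
def quad (a b c d : ℝ) : ℝ := b * c * d + a * c * d - a * b * d - a * b * c

/-- The integrand of the collision operator along the free flow, in terms of the pulled-back
function. -/
def colIntegrand (F : ℝ → R3 × R3 → ℝ) (s : ℝ) (z : R3 × R3) (a : R3 × S2) : ℝ :=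
  ‖z.2 - a.1‖ / 8 * quad (F s z) (F s (along s z a.1)) (F s (along s z (vel2 z.2 a.1 a.2)))
    (F s (along s z (vel3 z.2 a.1 a.2)))

/-- The collision operator along the free flow, in terms of the pulled-back function. -/
def colFlow (F : ℝ → R3 × R3 → ℝ) (s : ℝ) (z : R3 × R3) : ℝ :=
  ∫ a, colIntegrand F s z a ∂paramMeasure

/-- The time integral in the mild formulation, in terms of the pulled-back function. -/
def duhamel (F : ℝ → R3 × R3 → ℝ) (t : ℝ) (z : R3 × R3) : ℝ :=
  ∫ s in (0 : ℝ)..t, colFlow F s z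

/-- `|F| ≤ M ⟨α x⟩^{-p} ⟨β v⟩^{-q}` everywhere. -/
def WtBound (p q α β M : ℝ) (F : ℝ → R3 × R3 → ℝ) : Prop :=
  ∀ s z, |F s z| ≤ M * wt p q α β z

end

section Algebra

lemma abs_mul_mul_le {M u v w a b c : ℝ} (ha : |a| ≤ M * u) (hb : |b| ≤ M * v) (hc : |c| ≤ M * w) :
    |a * b * c| ≤ M ^ 3 * (u * v * w) := by
  rw [abs_mul, abs_mul]
  calc |a| * |b| * |c| ≤ (M * u) * (M * v) * (M * w) := by
        have := (abs_nonneg a).trans ha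
        have := (abs_nonneg b).trans hb
        gcongr
    _ = _ := by ring

lemma abs_mul_mul_sub_le {M D u v w a b c a' b' c' : ℝ}
    (hb : |b| ≤ M * v) (hc : |c| ≤ M * w)
    (ha' : |a'| ≤ M * u) (hb' : |b'| ≤ M * v)
    (hda : |a - a'| ≤ D * u) (hdb : |b - b'| ≤ D * v) (hdc : |c - c'| ≤ D * w) :
    |a * b * c - a' * b' * c'| ≤ 3 * M ^ 2 * D * (u * v * w) := by
  have e : a * b * c - a' * b' * c' = (a - a') * b * c + a' * (b - b') * c + a' * b' * (c - c') := by
    ring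
  have n1 := (abs_nonneg _).trans hb
  have n3 := (abs_nonneg _).trans ha'
  have n4 := (abs_nonneg _).trans hb'
  have n5 := (abs_nonneg _).trans hda
  have n6 := (abs_nonneg _).trans hdb
  rw [e]
  refine (abs_add_three _ _ _).trans ?_
  rw [abs_mul, abs_mul, abs_mul, abs_mul, abs_mul, abs_mul]
  calc |a - a'| * |b| * |c| + |a'| * |b - b'| * |c| + |a'| * |b'| * |c - c'|
      ≤ (D * u) * (M * v) * (M * w) + (M * u) * (D * v) * (M * w) + (M * u) * (M * v) * (D * w) := by
        gcongr
    _ = _ := by ring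

end Algebra

/-- Each of the four cubic terms telescopes into three differences, whence the factor `3 M² D`; the
four products of weights add up to `tripleSum`. -/
lemma abs_colIntegrand_sub_le {M D : ℝ} {F G : ℝ → R3 × R3 → ℝ} {s : ℝ}
    (hF : ∀ z, |F s z| ≤ M * wt p q α β z) (hG : ∀ z, |G s z| ≤ M * wt p q α β z)
    (hD : ∀ z, |F s z - G s z| ≤ D * wt p q α β z) (z : R3 × R3) (a : R3 × S2) :
    |colIntegrand F s z a - colIntegrand G s z a| ≤ 3 * M ^ 2 * D * kern p q α β s z a := by
  unfold colIntegrand kern tripleSum quad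
  set z₁ := along s z a.1
  set z₂ := along s z (vel2 z.2 a.1 a.2)
  set z₃ := along s z (vel3 z.2 a.1 a.2)
  have key := fun x y w : R3 × R3 => abs_mul_mul_sub_le (hF y) (hF w) (hG x) (hG y)
    (hD x) (hD y) (hD w)
  have h0 := key z₁ z₂ z₃
  have h1 := key z z₂ z₃
  have h2 := key z z₁ z₃
  have h3 := key z z₁ z₂
  rw [← mul_sub, abs_mul, abs_of_nonneg (by positivity : 0 ≤ ‖z.2 - a.1‖ / 8),
    mul_left_comm]
  refine mul_le_mul_of_nonneg_left ?_ (by positivity)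
  rw [abs_le] at *
  constructor <;> linarith [h0.1, h0.2, h1.1, h1.2, h2.1, h2.2, h3.1, h3.2]

/-! ### Joint measurability. -/

section Measurability

@[fun_prop]
lemma measurable_along_comp {X : Type*} [MeasurableSpace X] {s : X → ℝ} {f : X → R3 × R3}
    {g : X → R3} (hs : Measurable s) (hf : Measurable f) (hg : Measurable g) :
    Measurable fun x => along (s x) (f x) (g x) := by
  unfold along; fun_prop

@[fun_prop]
lemma measurable_vel2_comp {X : Type*} [MeasurableSpace X] {f g : X → R3} {h : X → S2}
    (hf : Measurable f) (hg : Measurable g) (hh : Measurable h) :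
    Measurable fun x => vel2 (f x) (g x) (h x) := by
  unfold vel2; fun_prop

@[fun_prop]
lemma measurable_vel3_comp {X : Type*} [MeasurableSpace X] {f g : X → R3} {h : X → S2}
    (hf : Measurable f) (hg : Measurable g) (hh : Measurable h) :
    Measurable fun x => vel3 (f x) (g x) (h x) := by
  unfold vel3; fun_prop

lemma measurable_apply_along {F : ℝ → R3 × R3 → ℝ} (hF : Measurable (Function.uncurry F))
    {X : Type*} [MeasurableSpace X] {s : X → ℝ} {f : X → R3 × R3} (hs : Measurable s)
    (hf : Measurable f) : Measurable fun x => F (s x) (f x) :=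
  hF.comp (hs.prodMk hf)

lemma measurable_colIntegrand_comp {F : ℝ → R3 × R3 → ℝ} (hF : Measurable (Function.uncurry F))
    {X : Type*} [MeasurableSpace X] {s : X → ℝ} {f : X → R3 × R3} {a : X → R3 × S2}
    (hs : Measurable s) (hf : Measurable f) (ha : Measurable a) :
    Measurable fun x => colIntegrand F (s x) (f x) (a x) := by
  unfold colIntegrand quad
  have h0 := measurable_apply_along hF hs hf
  have h1 := measurable_apply_along hF hs (by fun_prop : Measurable fun x =>
    along (s x) (f x) (a x).1)
  have h2 := measurable_apply_along hF hs (by fun_prop : Measurable fun x =>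
    along (s x) (f x) (vel2 (f x).2 (a x).1 (a x).2))
  have h3 := measurable_apply_along hF hs (by fun_prop : Measurable fun x =>
    along (s x) (f x) (vel3 (f x).2 (a x).1 (a x).2))
  fun_prop

lemma measurable_colFlow {F : ℝ → R3 × R3 → ℝ} (hF : Measurable (Function.uncurry F)) :
    Measurable fun y : ℝ × (R3 × R3) => colFlow F y.1 y.2 := by
  have h := measurable_colIntegrand_comp hF
    (by fun_prop : Measurable fun y : (ℝ × (R3 × R3)) × (R3 × S2) => y.1.1)
    (by fun_prop : Measurable fun y : (ℝ × (R3 × R3)) × (R3 × S2) => y.1.2)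
    (by fun_prop : Measurable fun y : (ℝ × (R3 × R3)) × (R3 × S2) => y.2)
  exact (h.stronglyMeasurable.integral_prod_right' (ν := paramMeasure)).measurable

lemma measurable_duhamel {F : ℝ → R3 × R3 → ℝ} (hF : Measurable (Function.uncurry F)) :
    Measurable (Function.uncurry (duhamel F)) := by
  have h := (measurable_colFlow hF).comp
    (by fun_prop : Measurable fun y : (ℝ × (R3 × R3)) × ℝ => (y.2, y.1.2))
  have h1 : MeasurableSet {y : (ℝ × (R3 × R3)) × ℝ | 0 < y.2 ∧ y.2 ≤ y.1.1} := by
    rw [ofPred_and]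
    exact (measurableSet_lt (by fun_prop) (by fun_prop)).inter
      (measurableSet_le (by fun_prop) (by fun_prop))
  have h2 : MeasurableSet {y : (ℝ × (R3 × R3)) × ℝ | y.1.1 < y.2 ∧ y.2 ≤ 0} := by
    rw [ofPred_and]
    exact (measurableSet_lt (by fun_prop) (by fun_prop)).inter
      (measurableSet_le (by fun_prop) (by fun_prop))
  have m1 := ((h.indicator h1).stronglyMeasurable.integral_prod_right'
    (ν := (volume : Measure ℝ))).measurable
  have m2 := ((h.indicator h2).stronglyMeasurable.integral_prod_right'
    (ν := (volume : Measure ℝ))).measurable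
  -- The interval integral is a difference of two integrals over `ℝ` of indicators, so that the
  -- dependence on the endpoint sits in a measurable integrand.
  convert m1.sub m2 using 1
  funext y
  simp only [Function.uncurry, duhamel, intervalIntegral, Pi.sub_apply]
  rw [← integral_indicator measurableSet_Ioc, ← integral_indicator measurableSet_Ioc]
  rfl

end Measurability

/-! ### Lipschitz and continuity estimates for the Duhamel term. -/

section Integrability

lemma integrable_kern (hp : 1 < p) (hq : 3 < q) (hα : 0 < α) (hβ : 0 < β) (z : R3 × R3) :
    Integrable (fun y : ℝ × (R3 × S2) => kern p q α β y.1 z y.2)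
      ((volume : Measure ℝ).prod paramMeasure) := by
  have hm : Continuous fun y : ℝ × (R3 × S2) => kern p q α β y.1 z y.2 := by fun_prop
  refine ⟨hm.aestronglyMeasurable, ?_⟩
  rw [hasFiniteIntegral_iff_ofReal (Eventually.of_forall fun y => kern_nonneg _ _ _)]
  exact (lintegral_kern_le hp hq hα hβ z).trans_lt ENNReal.ofReal_lt_top

noncomputable section

/-- The integral of the majorant over the parameters of the collision. -/
def kernFlow (p q α β : ℝ) (s : ℝ) (z : R3 × R3) : ℝ :=
  ∫ a, kern p q α β s z a ∂paramMeasure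

end

lemma kernFlow_nonneg (s : ℝ) (z : R3 × R3) : 0 ≤ kernFlow p q α β s z :=
  integral_nonneg fun _ => kern_nonneg _ _ _

lemma integrable_kernFlow (hp : 1 < p) (hq : 3 < q) (hα : 0 < α) (hβ : 0 < β) (z : R3 × R3) :
    Integrable fun s => kernFlow p q α β s z :=
  (integrable_kern hp hq hα hβ z).integral_prod_left

lemma integral_kernFlow_le (hp : 1 < p) (hq : 3 < q) (hα : 0 < α) (hβ : 0 < β) (z : R3 × R3) :
    ∫ s, kernFlow p q α β s z ≤ constC p q α β * wt p q α β z := by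
  have h := integral_prod _ (integrable_kern hp hq hα hβ z)
  unfold kernFlow
  rw [← h, integral_eq_lintegral_of_nonneg_ae (Eventually.of_forall fun y => kern_nonneg _ _ _)
    (integrable_kern hp hq hα hβ z).aestronglyMeasurable]
  exact ENNReal.toReal_le_of_le_ofReal
    (mul_nonneg (constC_pos hp hq hα hβ).le (wt_pos z).le) (lintegral_kern_le hp hq hα hβ z)

lemma setIntegral_kernFlow_le (hp : 1 < p) (hq : 3 < q) (hα : 0 < α) (hβ : 0 < β) (I : Set ℝ)
    (z : R3 × R3) : ∫ s in I, kernFlow p q α β s z ≤ constC p q α β * wt p q α β z :=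
  (setIntegral_le_integral (integrable_kernFlow hp hq hα hβ z)
    (Eventually.of_forall fun s => kernFlow_nonneg s z)).trans (integral_kernFlow_le hp hq hα hβ z)

lemma exists_setIntegral_kernFlow_le (hp : 1 < p) (hq : 3 < q) (hα : 0 < α) (hβ : 0 < β) {ε : ℝ}
    (hε : 0 < ε) : ∃ δ : ℝ, 0 < δ ∧ ∀ I : Set ℝ, volume I ≤ ENNReal.ofReal δ → ∀ z : R3 × R3,
      ∫ s in I, kernFlow p q α β s z ≤ ε * wt p q α β z := by
  obtain ⟨δ, hδ, h⟩ := exists_setLIntegral_kern_le hp hq hα hβ hε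
  refine ⟨δ, hδ, fun I hI z => ?_⟩
  have hi : Integrable (fun y : ℝ × (R3 × S2) => kern p q α β y.1 z y.2)
      ((volume.restrict I).prod paramMeasure) := by
    refine (integrable_kern hp hq hα hβ z).mono_measure ?_
    exact Measure.prod_mono Measure.restrict_le_self le_rfl
  have e := integral_prod _ hi
  unfold kernFlow
  rw [← e, integral_eq_lintegral_of_nonneg_ae (Eventually.of_forall fun y => kern_nonneg _ _ _)
    hi.aestronglyMeasurable]
  exact ENNReal.toReal_le_of_le_ofReal (mul_nonneg hε.le (wt_pos z).le) (h I hI z)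

lemma abs_colIntegrand_le {M : ℝ} {F : ℝ → R3 × R3 → ℝ} (hF : WtBound p q α β M F)
    (s : ℝ) (z : R3 × R3) (a : R3 × S2) :
    |colIntegrand F s z a| ≤ 3 * M ^ 3 * kern p q α β s z a := by
  have hM : 0 ≤ M := by
    have := (abs_nonneg _).trans (hF s z)
    exact nonneg_of_mul_nonneg_left this (wt_pos z)
  have h := abs_colIntegrand_sub_le (G := fun _ _ => 0) (D := M) (hF s)
    (fun z => by simpa using mul_nonneg hM (wt_pos z).le) (fun z => by simpa using hF s z) z a
  have e : colIntegrand (fun _ _ => 0) s z a = 0 := by simp [colIntegrand, quad]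
  rw [e, sub_zero] at h
  refine h.trans_eq ?_
  ring

lemma integrable_colIntegrand (hp : 1 < p) (hq : 3 < q) (hα : 0 < α) (hβ : 0 < β) {M : ℝ}
    {F : ℝ → R3 × R3 → ℝ} (hFm : Measurable (Function.uncurry F)) (hF : WtBound p q α β M F)
    (z : R3 × R3) :
    Integrable (fun y : ℝ × (R3 × S2) => colIntegrand F y.1 z y.2)
      ((volume : Measure ℝ).prod paramMeasure) :=
  ((integrable_kern hp hq hα hβ z).const_mul (3 * M ^ 3)).mono'
    (measurable_colIntegrand_comp hFm measurable_fst measurable_const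
      measurable_snd).aestronglyMeasurable
    (Eventually.of_forall fun y => abs_colIntegrand_le hF y.1 z y.2)

lemma integrable_colFlow (hp : 1 < p) (hq : 3 < q) (hα : 0 < α) (hβ : 0 < β) {M : ℝ}
    {F : ℝ → R3 × R3 → ℝ} (hFm : Measurable (Function.uncurry F)) (hF : WtBound p q α β M F)
    (z : R3 × R3) : Integrable fun s => colFlow F s z :=
  (integrable_colIntegrand hp hq hα hβ hFm hF z).integral_prod_left

lemma ae_abs_colFlow_sub_le (hp : 1 < p) (hq : 3 < q) (hα : 0 < α) (hβ : 0 < β) {M D : ℝ}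
    {F G : ℝ → R3 × R3 → ℝ} (hFm : Measurable (Function.uncurry F))
    (hGm : Measurable (Function.uncurry G)) (hF : WtBound p q α β M F) (hG : WtBound p q α β M G)
    (hD : WtBound p q α β D (F - G)) (z : R3 × R3) :
    ∀ᵐ s : ℝ, |colFlow F s z - colFlow G s z| ≤ 3 * M ^ 2 * D * kernFlow p q α β s z := by
  filter_upwards [(integrable_colIntegrand hp hq hα hβ hFm hF z).prod_right_ae,
    (integrable_colIntegrand hp hq hα hβ hGm hG z).prod_right_ae,
    (integrable_kern hp hq hα hβ z).prod_right_ae] with s h1 h2 h3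
  rw [colFlow, colFlow, kernFlow, ← integral_sub h1 h2, ← integral_const_mul, ← Real.norm_eq_abs]
  refine norm_integral_le_of_norm_le (h3.const_mul _) (Eventually.of_forall fun a => ?_)
  exact abs_colIntegrand_sub_le (hF s) (hG s) (hD s) z a

lemma abs_integral_colFlow_sub_le (hp : 1 < p) (hq : 3 < q) (hα : 0 < α) (hβ : 0 < β) {M D : ℝ}
    {F G : ℝ → R3 × R3 → ℝ} (hFm : Measurable (Function.uncurry F))
    (hGm : Measurable (Function.uncurry G)) (hF : WtBound p q α β M F) (hG : WtBound p q α β M G)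
    (hD : WtBound p q α β D (F - G)) (z : R3 × R3) (a b : ℝ) :
    |∫ s in a..b, (colFlow F s z - colFlow G s z)| ≤
      3 * M ^ 2 * D * ∫ s in uIoc a b, kernFlow p q α β s z := by
  rw [← integral_const_mul]
  refine (intervalIntegral.norm_integral_le_integral_norm_uIoc (f := fun s =>
    colFlow F s z - colFlow G s z)).trans ?_
  refine setIntegral_mono_ae
    ((integrable_colFlow hp hq hα hβ hFm hF z).sub
      (integrable_colFlow hp hq hα hβ hGm hG z)).norm.integrableOn
    ((integrable_kernFlow hp hq hα hβ z).const_mul _).integrableOn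
    (ae_abs_colFlow_sub_le hp hq hα hβ hFm hGm hF hG hD z)

/-- The contraction estimate. It holds at every point and for every real `t`, since the majorant is
integrable over the whole time axis. -/
lemma abs_duhamel_sub_le (hp : 1 < p) (hq : 3 < q) (hα : 0 < α) (hβ : 0 < β) {M D : ℝ}
    {F G : ℝ → R3 × R3 → ℝ} (hFm : Measurable (Function.uncurry F))
    (hGm : Measurable (Function.uncurry G)) (hF : WtBound p q α β M F) (hG : WtBound p q α β M G)
    (hD : WtBound p q α β D (F - G)) (t : ℝ) (z : R3 × R3) :
    |duhamel F t z - duhamel G t z| ≤ 3 * M ^ 2 * constC p q α β * D * wt p q α β z := by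
  have hD0 : 0 ≤ D := nonneg_of_mul_nonneg_left ((abs_nonneg _).trans (hD t z)) (wt_pos z)
  unfold duhamel
  rw [← intervalIntegral.integral_sub
    (integrable_colFlow hp hq hα hβ hFm hF z).intervalIntegrable
    (integrable_colFlow hp hq hα hβ hGm hG z).intervalIntegrable]
  refine (abs_integral_colFlow_sub_le hp hq hα hβ hFm hGm hF hG hD z 0 t).trans ?_
  refine (mul_le_mul_of_nonneg_left (setIntegral_kernFlow_le hp hq hα hβ _ z)
    (by positivity)).trans_eq ?_
  ring

lemma colFlow_zero (s : ℝ) (z : R3 × R3) : colFlow 0 s z = 0 := by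
  simp [colFlow, colIntegrand, quad]

lemma duhamel_zero (t : ℝ) (z : R3 × R3) : duhamel 0 t z = 0 := by
  simp [duhamel, colFlow_zero]

lemma WtBound.nonneg {M : ℝ} {F : ℝ → R3 × R3 → ℝ} (hF : WtBound p q α β M F) : 0 ≤ M :=
  nonneg_of_mul_nonneg_left ((abs_nonneg _).trans (hF 0 0)) (wt_pos 0)

lemma wtBound_zero {M : ℝ} (hM : 0 ≤ M) : WtBound p q α β M 0 := fun s z => by
  simpa using mul_nonneg hM (wt_pos z).le

lemma abs_duhamel_le (hp : 1 < p) (hq : 3 < q) (hα : 0 < α) (hβ : 0 < β) {M : ℝ}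
    {F : ℝ → R3 × R3 → ℝ} (hFm : Measurable (Function.uncurry F)) (hF : WtBound p q α β M F)
    (t : ℝ) (z : R3 × R3) :
    |duhamel F t z| ≤ 3 * M ^ 2 * constC p q α β * M * wt p q α β z := by
  have h := abs_duhamel_sub_le hp hq hα hβ hFm measurable_const hF (wtBound_zero hF.nonneg)
    (by simpa using hF) t z
  rwa [duhamel_zero, sub_zero] at h

lemma exists_abs_duhamel_sub_le (hp : 1 < p) (hq : 3 < q) (hα : 0 < α) (hβ : 0 < β) {M : ℝ}
    {F : ℝ → R3 × R3 → ℝ} (hFm : Measurable (Function.uncurry F)) (hF : WtBound p q α β M F)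
    {ε : ℝ} (hε : 0 < ε) : ∃ δ : ℝ, 0 < δ ∧ ∀ t s : ℝ, |t - s| ≤ δ → ∀ z : R3 × R3,
      |duhamel F t z - duhamel F s z| ≤ ε * wt p q α β z := by
  have hM := hF.nonneg
  obtain ⟨δ, hδ, h⟩ := exists_setIntegral_kernFlow_le hp hq hα hβ
    -- The `+ 1` keeps the denominator positive when `M = 0`.
    (div_pos hε (by positivity : 0 < 3 * M ^ 2 * M + 1))
  refine ⟨δ, hδ, fun t s hts z => ?_⟩
  have hi := integrable_colFlow hp hq hα hβ hFm hF z
  have e : duhamel F t z - duhamel F s z = ∫ r in s..t, (colFlow F r z - colFlow 0 r z) := by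
    simp only [colFlow_zero, sub_zero]
    exact intervalIntegral.integral_interval_sub_left hi.intervalIntegrable hi.intervalIntegrable
  rw [e]
  refine (abs_integral_colFlow_sub_le hp hq hα hβ hFm measurable_const hF (wtBound_zero hM)
    (by simpa using hF) z s t).trans ?_
  have hv : volume (uIoc s t) ≤ ENNReal.ofReal δ := by
    rw [Real.volume_uIoc]
    exact ENNReal.ofReal_le_ofReal hts
  refine (mul_le_mul_of_nonneg_left (h _ hv z) (by positivity)).trans ?_
  rw [← mul_assoc]
  refine mul_le_mul_of_nonneg_right ?_ (wt_pos z).le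
  rw [mul_div_assoc', div_le_iff₀ (by positivity)]
  nlinarith

end Integrability

/-! ### The weighted norm as an almost everywhere bound. -/

section WeightedNorm

lemma weight_mul_wt (z : R3 × R3) :
    bracket (α • z.1) ^ p * bracket (β • z.2) ^ q * wt p q α β z = 1 := by
  have h1 := bracket_pos (α • z.1)
  have h2 := bracket_pos (β • z.2)
  have h3 := bracket_rpow_neg_pos (α • z.1) p
  have h4 := bracket_rpow_neg_pos (β • z.2) q
  rw [wt, Real.rpow_neg h1.le, Real.rpow_neg h2.le]
  field_simp

lemma enorm_weight_mul_le_iff {c : ℝ} (hc : 0 ≤ c) (h : R3 × R3 → ℝ) (z : R3 × R3) :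
    ‖bracket (α • z.1) ^ p * bracket (β • z.2) ^ q * h z‖ₑ ≤ ENNReal.ofReal c ↔
      |h z| ≤ c * wt p q α β z := by
  have h3 := bracket_rpow_neg_pos (α • z.1) p
  have h4 := bracket_rpow_neg_pos (β • z.2) q
  have h5 := weight_mul_wt (p := p) (q := q) (α := α) (β := β) z
  set W := bracket (α • z.1) ^ p * bracket (β • z.2) ^ q with hW
  have hW0 : 0 < W := mul_pos h3 h4
  rw [← ofReal_norm, norm_mul, Real.norm_of_nonneg hW0.le, Real.norm_eq_abs]
  have e : c * wt p q α β z = c / W := by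
    rw [eq_div_iff hW0.ne', mul_assoc, mul_comm _ W, h5, mul_one]
  rw [e, le_div_iff₀ hW0, mul_comm]
  exact ENNReal.ofReal_le_ofReal_iff hc

lemma wNorm_le_iff {c : ℝ} (hc : 0 ≤ c) (h : R3 × R3 → ℝ) :
    wNorm p q α β h ≤ ENNReal.ofReal c ↔ ∀ᵐ z, |h z| ≤ c * wt p q α β z := by
  rw [wNorm, eLpNorm_exponent_top]
  constructor
  · intro hle
    filter_upwards [enorm_ae_le_eLpNormEssSup (fun z : R3 × R3 =>
      bracket (α • z.1) ^ p * bracket (β • z.2) ^ q * h z) volume] with z hz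
    exact (enorm_weight_mul_le_iff hc h z).1 (hz.trans hle)
  · intro hle
    exact eLpNormEssSup_le_of_ae_enorm_bound
      (hle.mono fun z hz => (enorm_weight_mul_le_iff hc h z).2 hz)

lemma ae_abs_le_of_wNorm_lt_top {h : R3 × R3 → ℝ} (hh : wNorm p q α β h < ∞) :
    ∀ᵐ z, |h z| ≤ (wNorm p q α β h).toReal * wt p q α β z :=
  (wNorm_le_iff ENNReal.toReal_nonneg h).1 (ENNReal.ofReal_toReal hh.ne).ge

lemma wNormT_le_iff {c : ℝ} (hc : 0 ≤ c) (T : ℝ) (g : ℝ → R3 × R3 → ℝ) :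
    wNormT p q α β T g ≤ ENNReal.ofReal c ↔
      ∀ t ∈ Icc 0 T, ∀ᵐ z, |g t z| ≤ c * wt p q α β z := by
  rw [wNormT, iSup₂_le_iff]
  exact forall₂_congr fun t _ => wNorm_le_iff hc (g t)

/-- Cutting off where the bound fails, and taking the positive part when that is allowed, turns
almost everywhere bounds on the data into bounds everywhere. The iteration can then be run
pointwise. -/
lemma exists_measurable_modification {c : ℝ} (hc : 0 ≤ c) {f : R3 × R3 → ℝ}
    (hf : AEStronglyMeasurable f volume) (hfc : ∀ᵐ z, |f z| ≤ c * wt p q α β z) :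
    ∃ g : R3 × R3 → ℝ, Measurable g ∧ g =ᵐ[volume] f ∧ (∀ z, |g z| ≤ c * wt p q α β z) ∧
      (0 ≤ᵐ[volume] f → ∀ z, 0 ≤ g z) := by
  obtain ⟨k, hk, hkf⟩ := hf.aemeasurable
  have hS : MeasurableSet {z | |k z| ≤ c * wt p q α β z} :=
    measurableSet_le (by fun_prop) (continuous_const.mul continuous_wt).measurable
  have hw : ∀ z, 0 ≤ c * wt p q α β z := fun z => mul_nonneg hc (wt_pos z).le
  set g := {z | |k z| ≤ c * wt p q α β z}.indicator k with hg
  have hgm : Measurable g := hk.indicator hS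
  have hgf : g =ᵐ[volume] f := by
    filter_upwards [hkf, hfc] with z h1 h2
    rw [hg, indicator_of_mem (by rw [h1] at h2; exact h2), h1]
  have hgb : ∀ z, |g z| ≤ c * wt p q α β z := fun z => by
    by_cases hz : z ∈ {z | |k z| ≤ c * wt p q α β z}
    · rw [hg, indicator_of_mem hz]; exact hz
    · rw [hg, indicator_of_notMem hz, abs_zero]; exact hw z
  by_cases h0 : 0 ≤ᵐ[volume] f
  · refine ⟨fun z => max (g z) 0, hgm.max measurable_const, ?_, fun z => ?_,
      fun _ z => le_max_right _ _⟩
    · filter_upwards [hgf, h0] with z h1 h2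
      rw [h1]; exact max_eq_left h2
    · exact (abs_le_abs_of_nonneg (le_max_right _ _)
        (max_le (le_abs_self _) (abs_nonneg _))).trans (by rw [abs_abs]; exact hgb z)
  · exact ⟨g, hgm, hgf, hgb, fun h => absurd h h0⟩

end WeightedNorm

/-! ### Construction of the fixed point. -/

section FixedPoint

noncomputable section

/-- The Picard iterates of the mild formulation. -/
def picard (f₀ : R3 × R3 → ℝ) : ℕ → ℝ → R3 × R3 → ℝ
  | 0 => 0
  | n + 1 => fun t z => f₀ z + duhamel (picard f₀ n) t z

end

lemma measurable_picard {f₀ : R3 × R3 → ℝ} (hf₀ : Measurable f₀) (n : ℕ) :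
    Measurable (Function.uncurry (picard f₀ n)) := by
  induction n with
  | zero => exact measurable_const
  | succ n ih => exact (hf₀.comp measurable_snd).add (measurable_duhamel ih)

/-- The data contribute `M/2` and the Duhamel term at most `M/4`. -/
lemma wtBound_add_duhamel (hp : 1 < p) (hq : 3 < q) (hα : 0 < α) (hβ : 0 < β) {M : ℝ}
    (hMC : 3 * M ^ 2 * constC p q α β ≤ 1 / 4) {f₀ : R3 × R3 → ℝ}
    (hf₀M : ∀ z, |f₀ z| ≤ M / 2 * wt p q α β z) {F : ℝ → R3 × R3 → ℝ}
    (hFm : Measurable (Function.uncurry F)) (hF : WtBound p q α β M F) :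
    WtBound p q α β M fun t z => f₀ z + duhamel F t z := fun t z => by
  have h := abs_duhamel_le hp hq hα hβ hFm hF t z
  have hw := wt_pos (p := p) (q := q) (α := α) (β := β) z
  have h2 : 3 * M ^ 2 * constC p q α β * M * wt p q α β z ≤ 1 / 4 * M * wt p q α β z := by
    have := hF.nonneg
    gcongr
  have h3 := hf₀M z
  have h4 : 0 ≤ M * wt p q α β z := mul_nonneg hF.nonneg hw.le
  refine (abs_add_le _ _).trans ?_
  linarith

lemma wtBound_picard (hp : 1 < p) (hq : 3 < q) (hα : 0 < α) (hβ : 0 < β) {M : ℝ} (hM : 0 ≤ M)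
    (hMC : 3 * M ^ 2 * constC p q α β ≤ 1 / 4) {f₀ : R3 × R3 → ℝ} (hf₀ : Measurable f₀)
    (hf₀M : ∀ z, |f₀ z| ≤ M / 2 * wt p q α β z) (n : ℕ) : WtBound p q α β M (picard f₀ n) := by
  induction n with
  | zero => exact wtBound_zero hM
  | succ n ih => exact wtBound_add_duhamel hp hq hα hβ hMC hf₀M (measurable_picard hf₀ n) ih

lemma wtBound_picard_sub (hp : 1 < p) (hq : 3 < q) (hα : 0 < α) (hβ : 0 < β) {M : ℝ} (hM : 0 ≤ M)
    (hMC : 3 * M ^ 2 * constC p q α β ≤ 1 / 4) {f₀ : R3 × R3 → ℝ} (hf₀ : Measurable f₀)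
    (hf₀M : ∀ z, |f₀ z| ≤ M / 2 * wt p q α β z) (n : ℕ) :
    WtBound p q α β (M * (1 / 2) ^ n) (picard f₀ n - picard f₀ (n + 1)) := by
  induction n with
  | zero =>
    intro t z
    have := wtBound_picard hp hq hα hβ hM hMC hf₀ hf₀M 1 t z
    rw [Pi.sub_apply, Pi.sub_apply, abs_sub_comm]
    simpa [picard] using this
  | succ n ih =>
    intro t z
    have h := abs_duhamel_sub_le hp hq hα hβ (measurable_picard hf₀ n)
      (measurable_picard hf₀ (n + 1)) (wtBound_picard hp hq hα hβ hM hMC hf₀ hf₀M n)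
      (wtBound_picard hp hq hα hβ hM hMC hf₀ hf₀M (n + 1)) ih t z
    have e : (picard f₀ (n + 1) - picard f₀ (n + 1 + 1)) t z =
        duhamel (picard f₀ n) t z - duhamel (picard f₀ (n + 1)) t z := by
      change f₀ z + duhamel (picard f₀ n) t z - (f₀ z + duhamel (picard f₀ (n + 1)) t z) = _
      ring
    have hw := wt_pos (p := p) (q := q) (α := α) (β := β) z
    rw [e]
    refine h.trans ?_
    have e2 : M * (1 / 2 : ℝ) ^ (n + 1) = M * (1 / 2) ^ n / 2 := by ring
    rw [e2]
    have h0 : 0 ≤ M * (1 / 2) ^ n := by positivity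
    have h1 := mul_le_mul_of_nonneg_right hMC h0
    refine mul_le_mul_of_nonneg_right ?_ hw.le
    nlinarith

lemma exists_fixedPoint (hp : 1 < p) (hq : 3 < q) (hα : 0 < α) (hβ : 0 < β) {M : ℝ} (hM : 0 ≤ M)
    (hMC : 3 * M ^ 2 * constC p q α β ≤ 1 / 4) {f₀ : R3 × R3 → ℝ} (hf₀ : Measurable f₀)
    (hf₀M : ∀ z, |f₀ z| ≤ M / 2 * wt p q α β z) :
    ∃ F : ℝ → R3 × R3 → ℝ, Measurable (Function.uncurry F) ∧ WtBound p q α β M F ∧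
      ∀ t z, F t z = f₀ z + duhamel F t z := by
  have hd : ∀ t z n, dist (picard f₀ n t z) (picard f₀ (n + 1) t z) ≤
      M * wt p q α β z * (1 / 2) ^ n := fun t z n => by
    refine (wtBound_picard_sub hp hq hα hβ hM hMC hf₀ hf₀M n t z).trans_eq ?_
    ring
  have hlim : ∀ t z, ∃ l, Tendsto (fun n => picard f₀ n t z) atTop (𝓝 l) := fun t z =>
    cauchySeq_tendsto_of_complete (cauchySeq_of_le_geometric _ _ (by norm_num) (hd t z))
  choose F hF using hlim
  have hFm : Measurable (Function.uncurry F) :=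
    measurable_of_tendsto_metrizable (measurable_picard hf₀)
      (tendsto_pi_nhds.2 fun y => hF y.1 y.2)
  have hFb : WtBound p q α β M F := fun t z =>
    le_of_tendsto (hF t z).abs
      (Eventually.of_forall fun n => wtBound_picard hp hq hα hβ hM hMC hf₀ hf₀M n t z)
  -- The factor `2` sums the geometric tail.
  have hFd : ∀ n, WtBound p q α β (2 * M * (1 / 2) ^ n) (picard f₀ n - F) := fun n t z => by
    refine (dist_le_of_le_geometric_of_tendsto _ _ (by norm_num) (hd t z) (hF t z) n).trans_eq ?_
    ring
  refine ⟨F, hFm, hFb, fun t z => ?_⟩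
  refine tendsto_nhds_unique ((tendsto_add_atTop_iff_nat 1).2 (hF t z)) ?_
  refine Tendsto.const_add _ ?_
  rw [tendsto_iff_dist_tendsto_zero]
  have hz : Tendsto (fun n : ℕ => 3 * M ^ 2 * constC p q α β * (2 * M * (1 / 2) ^ n) *
      wt p q α β z) atTop (𝓝 0) := by
    have := tendsto_pow_atTop_nhds_zero_of_lt_one (r := (1 / 2 : ℝ)) (by norm_num) (by norm_num)
    simpa using ((this.const_mul (2 * M)).const_mul (3 * M ^ 2 * constC p q α β)).mul_const
      (wt p q α β z)
  refine squeeze_zero (fun _ => dist_nonneg) (fun n => ?_) hz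
  exact abs_duhamel_sub_le hp hq hα hβ (measurable_picard hf₀ n) hFm
    (wtBound_picard hp hq hα hβ hM hMC hf₀ hf₀M n) hFb (hFd n) t z

end FixedPoint

/-! ### From fixed points to mild solutions. -/

section Mild

lemma pullback_transport (F : ℝ → R3 × R3 → ℝ) :
    pullback (fun t => transport t (F t)) = F := by
  funext t z
  simp [pullback, transport]

lemma apply_eq_pullback_along (f : ℝ → R3 × R3 → ℝ) (s : ℝ) (z : R3 × R3) (w : R3) :
    f s (z.1 + s • z.2, w) = pullback f s (along s z w) := by
  simp only [pullback, transport, along]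
  congr 2
  module

lemma integral_add_sub_sub {A : Type*} [MeasurableSpace A] {μ : Measure A} {a b c d : A → ℝ}
    (ha : Integrable a μ) (hb : Integrable b μ) (hc : Integrable c μ) (hd : Integrable d μ) :
    ∫ x, (a x + b x - c x - d x) ∂μ = ∫ x, a x ∂μ + ∫ x, b x ∂μ - ∫ x, c x ∂μ - ∫ x, d x ∂μ := by
  have h1 : Integrable (fun x => a x + b x) μ := ha.add hb
  have h2 : Integrable (fun x => a x + b x - c x) μ := h1.sub hc
  rw [integral_sub h2 hd, integral_sub h1 hc, integral_add ha hb]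

lemma transport_collisionAt (f : ℝ → R3 × R3 → ℝ) (s : ℝ) (z : R3 × R3)
    (h : CollisionConverges (fun w => f s (z.1 + s • z.2, w)) z.2) :
    transport (-s) (collisionAt f s) z = colFlow (pullback f) s z := by
  obtain ⟨h0, h1, h2, h3⟩ := h
  have e : transport (-s) (collisionAt f s) z =
      collision (fun w => f s (z.1 + s • z.2, w)) z.2 := by
    simp [transport, collisionAt]
  rw [e, collision, L0, L1, L2, L3, resonantIntegral, resonantIntegral, resonantIntegral,
    resonantIntegral, ← integral_add_sub_sub h0 h1 h2 h3, colFlow]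
  refine integral_congr_ae (Eventually.of_forall fun a => ?_)
  simp only [resonantDensity, apply_eq_pullback_along, along_self,
    colIntegrand, quad]
  ring

lemma ae_collisionConverges (hp : 1 < p) (hq : 3 < q) (hα : 0 < α) (hβ : 0 < β) {M : ℝ}
    {f : ℝ → R3 × R3 → ℝ} (hfm : Measurable (Function.uncurry (pullback f)))
    (hf : WtBound p q α β M (pullback f)) (z : R3 × R3) :
    ∀ᵐ s : ℝ, CollisionConverges (fun w => f s (z.1 + s • z.2, w)) z.2 := by
  have hM := hf.nonneg
  filter_upwards [(integrable_kern hp hq hα hβ z).prod_right_ae] with s hs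
  have m0 : Measurable fun _ : R3 × S2 => pullback f s z := measurable_const
  have m1 : Measurable fun a : R3 × S2 => pullback f s (along s z a.1) :=
    measurable_apply_along hfm measurable_const (by fun_prop)
  have m2 : Measurable fun a : R3 × S2 => pullback f s (along s z (vel2 z.2 a.1 a.2)) :=
    measurable_apply_along hfm measurable_const (by fun_prop)
  have m3 : Measurable fun a : R3 × S2 => pullback f s (along s z (vel3 z.2 a.1 a.2)) :=
    measurable_apply_along hfm measurable_const (by fun_prop)
  have hw := fun y => (wt_pos (p := p) (q := q) (α := α) (β := β) y).le
  have key : ∀ b : R3 × S2 → ℝ, Measurable b →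
      (∀ a, |b a| ≤ M ^ 3 * tripleSum p q α β s z a) →
      Integrable (fun a : R3 × S2 => ‖z.2 - a.1‖ / 8 * b a) paramMeasure := fun b hb hle => by
    refine (hs.const_mul (M ^ 3)).mono' (by fun_prop) (Eventually.of_forall fun a => ?_)
    rw [norm_mul, Real.norm_of_nonneg (by positivity), kern, mul_left_comm]
    exact mul_le_mul_of_nonneg_left (hle a) (by positivity)
  have hM3 : 0 ≤ M ^ 3 := by positivity
  have ts : ∀ a, ∀ c ∈ ({wt p q α β (along s z a.1) * wt p q α β (along s z (vel2 z.2 a.1 a.2)) *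
      wt p q α β (along s z (vel3 z.2 a.1 a.2)), wt p q α β z * wt p q α β
      (along s z (vel2 z.2 a.1 a.2)) * wt p q α β (along s z (vel3 z.2 a.1 a.2)), wt p q α β z *
      wt p q α β (along s z a.1) * wt p q α β (along s z (vel3 z.2 a.1 a.2)), wt p q α β z *
      wt p q α β (along s z a.1) * wt p q α β (along s z (vel2 z.2 a.1 a.2))} : Set ℝ),
      M ^ 3 * c ≤ M ^ 3 * tripleSum p q α β s z a := fun a c hc => by
    have h0 := hw z
    have h1 := hw (along s z a.1)
    have h2 := hw (along s z (vel2 z.2 a.1 a.2))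
    have h3 := hw (along s z (vel3 z.2 a.1 a.2))
    have e0 := mul_nonneg (mul_nonneg h1 h2) h3
    have e1 := mul_nonneg (mul_nonneg h0 h2) h3
    have e2 := mul_nonneg (mul_nonneg h0 h1) h3
    have e3 := mul_nonneg (mul_nonneg h0 h1) h2
    refine mul_le_mul_of_nonneg_left ?_ hM3
    simp only [mem_insert_iff, mem_singleton_iff] at hc
    unfold tripleSum
    rcases hc with rfl | rfl | rfl | rfl <;> linarith
  unfold CollisionConverges ResonantIntegrable resonantDensity
  simp only [apply_eq_pullback_along, along_self]
  refine ⟨key _ (by fun_prop) fun a => ?_, key _ (by fun_prop) fun a => ?_,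
    key _ (by fun_prop) fun a => ?_, key _ (by fun_prop) fun a => ?_⟩ <;>
  exact (abs_mul_mul_le (hf s _) (hf s _) (hf s _)).trans (ts a _ (by simp))

lemma memXT_of_fixedPoint (hp : 1 < p) (hq : 3 < q) (hα : 0 < α) (hβ : 0 < β) {M : ℝ}
    {g₀ : R3 × R3 → ℝ} {F : ℝ → R3 × R3 → ℝ}
    (hFm : Measurable (Function.uncurry F)) (hF : WtBound p q α β M F)
    (hfix : ∀ t z, F t z = g₀ z + duhamel F t z) (T : ℝ) : MemXT p q α β T F := by
  constructor
  · intro t _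
    have hm : Measurable (F t) := measurable_apply_along hFm measurable_const measurable_id
    exact ⟨hm.aestronglyMeasurable,
      ((wNorm_le_iff hF.nonneg _).2 (Eventually.of_forall (hF t))).trans_lt ENNReal.ofReal_lt_top⟩
  · intro t _
    rw [ENNReal.tendsto_nhds_zero]
    intro ε hε
    obtain ⟨r, hr0, hr⟩ := ENNReal.lt_iff_exists_real_btwn.1 hε
    have hr1 : 0 < r := ENNReal.ofReal_pos.1 hr.1
    obtain ⟨δ, hδ, h⟩ := exists_abs_duhamel_sub_le hp hq hα hβ hFm hF hr1
    have : ∀ᶠ s in 𝓝[Icc 0 T] t, |s - t| < δ :=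
      mem_nhdsWithin_of_mem_nhds (Metric.ball_mem_nhds t hδ)
    filter_upwards [this] with s hs
    refine le_trans ?_ hr.2.le
    refine (wNorm_le_iff hr1.le _).2 (Eventually.of_forall fun z => ?_)
    -- The data cancel, so continuity in time is the uniform continuity of the Duhamel term.
    rw [Pi.sub_apply, hfix s z, hfix t z, add_sub_add_left_eq_sub]
    exact h s t hs.le z

lemma isMildSolution_of_fixedPoint (hp : 1 < p) (hq : 3 < q) (hα : 0 < α) (hβ : 0 < β) {M : ℝ}
    {f₀ g₀ : R3 × R3 → ℝ} (hfg : g₀ =ᵐ[volume] f₀) {F : ℝ → R3 × R3 → ℝ}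
    (hFm : Measurable (Function.uncurry F)) (hF : WtBound p q α β M F)
    (hfix : ∀ t z, F t z = g₀ z + duhamel F t z) (T : ℝ) :
    IsMildSolution p q α β T f₀ fun t => transport t (F t) := by
  have hpull := pullback_transport F
  have hmeas : Measurable fun y : ℝ × (R3 × R3) => transport y.1 (F y.1) y.2 :=
    measurable_apply_along hFm (s := fun y : ℝ × (R3 × R3) => y.1)
      (f := fun y : ℝ × (R3 × R3) => (y.2.1 - y.1 • y.2.2, y.2.2)) (by fun_prop) (by fun_prop)
  set f : ℝ → R3 × R3 → ℝ := fun t => transport t (F t) with hf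
  clear_value f
  have hconv : ∀ z : R3 × R3, ∀ᵐ s : ℝ, CollisionConverges (fun w => f s (z.1 + s • z.2, w)) z.2 :=
    fun z => ae_collisionConverges (f := f) hp hq hα hβ (by rwa [hpull]) (by rwa [hpull]) z
  have hcol : ∀ z, ∀ᵐ s : ℝ, transport (-s) (collisionAt f s) z = colFlow F s z := fun z => by
    filter_upwards [hconv z] with s hs
    rw [transport_collisionAt _ _ _ hs, hpull]
  refine ⟨?_, ?_, ?_, ?_, ?_⟩
  · simpa only [hf] using hmeas.aestronglyMeasurable
  · rw [hpull]
    exact memXT_of_fixedPoint hp hq hα hβ hFm hF hfix T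
  · exact Eventually.of_forall fun z => ae_restrict_of_ae (hconv z)
  · exact Eventually.of_forall fun z => ((integrable_colFlow hp hq hα hβ hFm hF z).congr
      ((hcol z).mono fun s hs => hs.symm)).integrableOn
  · intro t _
    filter_upwards [hfg] with z hz
    rw [hpull, hfix, hz, duhamel]
    congr 1
    exact intervalIntegral.integral_congr_ae ((hcol z).mono fun s hs _ => hs.symm)

end Mild

/-! ### Representatives of an arbitrary mild solution. -/

section Transfer

/-- The integrand evaluates the function at four points, and each evaluation map is
quasi-measure-preserving, so the exceptional set pulls back to a null set. -/
lemma ae_colIntegrand_congr (μ : Measure ℝ) [SFinite μ] {F G : ℝ → R3 × R3 → ℝ}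
    (hFG : ∀ᵐ y : ℝ × (R3 × R3) ∂(μ.prod volume), F y.1 y.2 = G y.1 y.2) :
    ∀ᵐ z : R3 × R3, ∀ᵐ y : ℝ × (R3 × S2) ∂(μ.prod paramMeasure),
      colIntegrand F y.1 z y.2 = colIntegrand G y.1 z y.2 := by
  refine Measure.ae_ae_of_ae_prod (p := fun y : (R3 × R3) × (ℝ × (R3 × S2)) =>
    colIntegrand F y.2.1 y.1 y.2.2 = colIntegrand G y.2.1 y.1 y.2.2) ?_
  have h0 := (quasiMeasurePreserving_along μ paramMeasure
    Measure.quasiMeasurePreserving_fst).ae hFG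
  have h1 := (quasiMeasurePreserving_along μ paramMeasure
    quasiMeasurePreserving_fst_param).ae hFG
  have h2 := (quasiMeasurePreserving_along μ paramMeasure quasiMeasurePreserving_vel2).ae hFG
  have h3 := (quasiMeasurePreserving_along μ paramMeasure quasiMeasurePreserving_vel3).ae hFG
  filter_upwards [h0, h1, h2, h3] with y e0 e1 e2 e3
  simp only [along_self] at e0 e1 e2 e3
  rw [colIntegrand, colIntegrand, e0, e1, e2, e3]

lemma ae_colFlow_congr (μ : Measure ℝ) [SFinite μ] {F G : ℝ → R3 × R3 → ℝ}
    (hFG : ∀ᵐ y : ℝ × (R3 × R3) ∂(μ.prod volume), F y.1 y.2 = G y.1 y.2) :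
    ∀ᵐ z : R3 × R3, ∀ᵐ s ∂μ, colFlow F s z = colFlow G s z := by
  filter_upwards [ae_colIntegrand_congr μ hFG] with z hz
  filter_upwards [Measure.ae_ae_of_ae_prod hz] with s hs
  exact integral_congr_ae hs

lemma IsMildSolution.equation_duhamel {T : ℝ} {f₀ : R3 × R3 → ℝ} {f F : ℝ → R3 × R3 → ℝ}
    (hf : IsMildSolution p q α β T f₀ f)
    (hF : ∀ᵐ y : ℝ × (R3 × R3) ∂((volume.restrict (Icc 0 T)).prod volume),
      F y.1 y.2 = pullback f y.1 y.2) :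
    ∀ t ∈ Icc 0 T, ∀ᵐ z : R3 × R3, pullback f t z = f₀ z + duhamel F t z := by
  intro t ht
  filter_upwards [hf.equation t ht, hf.converges, ae_colFlow_congr _ hF] with z h1 h2 h3
  rw [h1, duhamel]
  congr 1
  refine intervalIntegral.integral_congr_ae ?_
  have h4 : ∀ᵐ s ∂(volume.restrict (Icc 0 T)),
      transport (-s) (collisionAt f s) z = colFlow F s z := by
    filter_upwards [h2, h3] with s h5 h6
    rw [transport_collisionAt f s z h5, h6]
  filter_upwards [(ae_restrict_iff' measurableSet_Icc).1 h4] with s hs hst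
  rw [uIoc_of_le ht.1] at hst
  exact hs ⟨hst.1.le, hst.2.trans ht.2⟩

lemma IsMildSolution.exists_measurable {T : ℝ} {f₀ : R3 × R3 → ℝ} {f : ℝ → R3 × R3 → ℝ}
    (hf : IsMildSolution p q α β T f₀ f) :
    ∃ k : ℝ → R3 × R3 → ℝ, Measurable (Function.uncurry k) ∧
      ∀ᵐ y : ℝ × (R3 × R3) ∂((volume.restrict (Icc 0 T)).prod volume),
        k y.1 y.2 = pullback f y.1 y.2 := by
  have h := (hf.measurable.comp_quasiMeasurePreserving
    (measurePreserving_transport_time (volume.restrict (Icc 0 T))).quasiMeasurePreserving)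
  obtain ⟨k, hk, hkf⟩ := h.aemeasurable
  refine ⟨fun t z => k (t, z), hk, ?_⟩
  filter_upwards [hkf] with y hy
  rw [← hy]
  simp [pullback, transport]

/-- A property of the values of two solutions that holds at every time almost everywhere holds
almost everywhere in time, position and velocity for measurable representatives. -/
lemma ae_prod_of_forall_ae {T : ℝ} {f k g l : ℝ → R3 × R3 → ℝ}
    (hk : Measurable (Function.uncurry k)) (hl : Measurable (Function.uncurry l))
    (hkf : ∀ᵐ y : ℝ × (R3 × R3) ∂((volume.restrict (Icc 0 T)).prod volume), k y.1 y.2 = f y.1 y.2)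
    (hlg : ∀ᵐ y : ℝ × (R3 × R3) ∂((volume.restrict (Icc 0 T)).prod volume), l y.1 y.2 = g y.1 y.2)
    {D : ℝ} (h : ∀ t ∈ Icc 0 T, ∀ᵐ z, |f t z - g t z| ≤ D * wt p q α β z) :
    ∀ᵐ y : ℝ × (R3 × R3) ∂((volume.restrict (Icc 0 T)).prod volume),
      |k y.1 y.2 - l y.1 y.2| ≤ D * wt p q α β y.2 := by
  have hk' : Measurable fun y : ℝ × (R3 × R3) => k y.1 y.2 := hk
  have hl' : Measurable fun y : ℝ × (R3 × R3) => l y.1 y.2 := hl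
  have hw : Measurable fun y : ℝ × (R3 × R3) => D * wt p q α β y.2 :=
    (continuous_const.mul (continuous_wt.comp continuous_snd)).measurable
  have hS : MeasurableSet {y : ℝ × (R3 × R3) | |k y.1 y.2 - l y.1 y.2| ≤ D * wt p q α β y.2} :=
    measurableSet_le (by fun_prop) hw
  refine (Measure.ae_prod_iff_ae_ae hS).2 ?_
  filter_upwards [Measure.ae_ae_of_ae_prod hkf, Measure.ae_ae_of_ae_prod hlg,
    ae_restrict_mem measurableSet_Icc] with t h1 h2 ht
  filter_upwards [h1, h2, h t ht] with z e1 e2 e3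
  rwa [e1, e2]

/-- Both representatives are cut off to one common set, on which all three bounds hold; outside it
both vanish, so the bound on the difference survives. They agree with the solutions only for almost
every `(t, x, v)`, which is why the pullbacks remain on the left of the two equations. -/
lemma exists_pair_representatives {T M D : ℝ} (hM : 0 ≤ M) (hD : 0 ≤ D)
    {f₀ g₀ : R3 × R3 → ℝ} {f g : ℝ → R3 × R3 → ℝ}
    (hf : IsMildSolution p q α β T f₀ f) (hg : IsMildSolution p q α β T g₀ g)
    (hfM : ∀ t ∈ Icc 0 T, ∀ᵐ z, |pullback f t z| ≤ M * wt p q α β z)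
    (hgM : ∀ t ∈ Icc 0 T, ∀ᵐ z, |pullback g t z| ≤ M * wt p q α β z)
    (hfg : ∀ t ∈ Icc 0 T, ∀ᵐ z, |pullback f t z - pullback g t z| ≤ D * wt p q α β z) :
    ∃ F G : ℝ → R3 × R3 → ℝ, Measurable (Function.uncurry F) ∧ Measurable (Function.uncurry G) ∧
      WtBound p q α β M F ∧ WtBound p q α β M G ∧ WtBound p q α β D (F - G) ∧
      (∀ t ∈ Icc 0 T, ∀ᵐ z, pullback f t z = f₀ z + duhamel F t z) ∧
      (∀ t ∈ Icc 0 T, ∀ᵐ z, pullback g t z = g₀ z + duhamel G t z) := by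
  obtain ⟨k, hk, hkf⟩ := hf.exists_measurable
  obtain ⟨l, hl, hlg⟩ := hg.exists_measurable
  have h0 : ∀ᵐ y : ℝ × (R3 × R3) ∂((volume.restrict (Icc 0 T)).prod volume),
      (0 : ℝ → R3 × R3 → ℝ) y.1 y.2 = (0 : ℝ → R3 × R3 → ℝ) y.1 y.2 :=
    Eventually.of_forall fun _ => rfl
  have b1 := ae_prod_of_forall_ae (p := p) (q := q) (α := α) (β := β) (D := M) hk measurable_const
    hkf h0 (by simpa using hfM)
  have b2 := ae_prod_of_forall_ae (p := p) (q := q) (α := α) (β := β) (D := M) hl measurable_const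
    hlg h0 (by simpa using hgM)
  have b3 := ae_prod_of_forall_ae hk hl hkf hlg hfg
  simp only [Pi.zero_apply, sub_zero] at b1 b2
  set S : Set (ℝ × (R3 × R3)) := {y | |k y.1 y.2| ≤ M * wt p q α β y.2} ∩
    ({y | |l y.1 y.2| ≤ M * wt p q α β y.2} ∩
      {y | |k y.1 y.2 - l y.1 y.2| ≤ D * wt p q α β y.2}) with hS
  have hw : ∀ c : ℝ, Measurable fun y : ℝ × (R3 × R3) => c * wt p q α β y.2 := fun c =>
    (continuous_const.mul (continuous_wt.comp continuous_snd)).measurable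
  have hk' : Measurable fun y : ℝ × (R3 × R3) => k y.1 y.2 := hk
  have hl' : Measurable fun y : ℝ × (R3 × R3) => l y.1 y.2 := hl
  have hSm : MeasurableSet S :=
    (measurableSet_le (by fun_prop) (hw M)).inter
      ((measurableSet_le (by fun_prop) (hw M)).inter (measurableSet_le (by fun_prop) (hw D)))
  have hSae : ∀ᵐ y ∂((volume.restrict (Icc 0 T)).prod volume), y ∈ S := by
    filter_upwards [b1, b2, b3] with y e1 e2 e3 using ⟨e1, e2, e3⟩
  refine ⟨fun t z => S.indicator (Function.uncurry k) (t, z),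
    fun t z => S.indicator (Function.uncurry l) (t, z), hk.indicator hSm, hl.indicator hSm,
    ?_, ?_, ?_, hf.equation_duhamel ?_, hg.equation_duhamel ?_⟩
  · intro t z
    by_cases h : (t, z) ∈ S
    · simp only [indicator_of_mem h]
      exact h.1
    · simpa only [indicator_of_notMem h, abs_zero] using mul_nonneg hM (wt_pos z).le
  · intro t z
    by_cases h : (t, z) ∈ S
    · simp only [indicator_of_mem h]
      exact h.2.1
    · simpa only [indicator_of_notMem h, abs_zero] using mul_nonneg hM (wt_pos z).le
  · intro t z
    by_cases h : (t, z) ∈ S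
    · simp only [Pi.sub_apply, indicator_of_mem h]
      exact h.2.2
    · simpa only [Pi.sub_apply, indicator_of_notMem h, sub_zero, abs_zero] using
        mul_nonneg hD (wt_pos z).le
  · filter_upwards [hkf, hSae] with y h1 h2
    rw [← h1]
    exact indicator_of_mem h2 _
  · filter_upwards [hlg, hSae] with y h1 h2
    rw [← h1]
    exact indicator_of_mem h2 _

end Transfer

/-! ### Stability and uniqueness. -/

section Stability

/-- A bound `D` on the difference improves to `d + D/4`. Starting from the trivial `2M`, the
iteration drops below any number larger than `2d`. -/
lemma ae_abs_sub_le_of_isMildSolution (hp : 1 < p) (hq : 3 < q) (hα : 0 < α) (hβ : 0 < β)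
    {T M d : ℝ} (hM : 0 ≤ M) (hMC : 3 * M ^ 2 * constC p q α β ≤ 1 / 4) (hd : 0 ≤ d)
    {f₀ g₀ : R3 × R3 → ℝ} {f g : ℝ → R3 × R3 → ℝ}
    (hf : IsMildSolution p q α β T f₀ f) (hg : IsMildSolution p q α β T g₀ g)
    (hfM : ∀ t ∈ Icc 0 T, ∀ᵐ z, |pullback f t z| ≤ M * wt p q α β z)
    (hgM : ∀ t ∈ Icc 0 T, ∀ᵐ z, |pullback g t z| ≤ M * wt p q α β z)
    (hfg : ∀ᵐ z, |f₀ z - g₀ z| ≤ d * wt p q α β z) :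
    ∀ t ∈ Icc 0 T, ∀ᵐ z, |pullback f t z - pullback g t z| ≤ 2 * d * wt p q α β z := by
  have step : ∀ D : ℝ, 0 ≤ D →
      (∀ t ∈ Icc 0 T, ∀ᵐ z, |pullback f t z - pullback g t z| ≤ D * wt p q α β z) →
      ∀ t ∈ Icc 0 T, ∀ᵐ z, |pullback f t z - pullback g t z| ≤
        (d + D / 4) * wt p q α β z := by
    intro D hD h t ht
    obtain ⟨F, G, hFm, hGm, hF, hG, hFG, eF, eG⟩ :=
      exists_pair_representatives hM hD hf hg hfM hgM h
    filter_upwards [eF t ht, eG t ht, hfg] with z h1 h2 h3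
    have h4 := abs_duhamel_sub_le hp hq hα hβ hFm hGm hF hG hFG t z
    have h5 : 3 * M ^ 2 * constC p q α β * D * wt p q α β z ≤ 1 / 4 * D * wt p q α β z := by
      have := (wt_pos (p := p) (q := q) (α := α) (β := β) z).le
      gcongr
    rw [h1, h2, add_sub_add_comm]
    refine (abs_add_le _ _).trans ?_
    linarith
  have iter : ∀ n : ℕ, ∀ t ∈ Icc 0 T, ∀ᵐ z, |pullback f t z - pullback g t z| ≤
      (2 * d + 2 * M * (1 / 4) ^ n) * wt p q α β z := by
    intro n
    induction n with
    | zero =>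
      intro t ht
      filter_upwards [hfM t ht, hgM t ht] with z h1 h2
      have := (wt_pos (p := p) (q := q) (α := α) (β := β) z).le
      have h3 := mul_nonneg hd this
      refine (abs_sub _ _).trans ?_
      rw [pow_zero]
      linarith
    | succ n ih =>
      intro t ht
      filter_upwards [step _ (by positivity) ih t ht] with z hz
      refine hz.trans (mul_le_mul_of_nonneg_right ?_ (wt_pos z).le)
      rw [pow_succ]
      linarith
  intro t ht
  -- Countably many null sets are discarded at once, and then `n → ∞` at a fixed point.
  filter_upwards [ae_all_iff.2 fun n => iter n t ht] with z hz
  have hlim : Tendsto (fun n : ℕ => (2 * d + 2 * M * (1 / 4 : ℝ) ^ n) * wt p q α β z) atTop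
      (𝓝 ((2 * d + 2 * M * 0) * wt p q α β z)) :=
    (((tendsto_pow_atTop_nhds_zero_of_lt_one (by norm_num) (by norm_num)).const_mul
      (2 * M)).const_add (2 * d)).mul_const _
  have := ge_of_tendsto' hlim hz
  simpa using this

lemma ae_eq_of_pullback_ae_eq {f g : ℝ → R3 × R3 → ℝ} {t : ℝ}
    (h : pullback f t =ᵐ[volume] pullback g t) : f t =ᵐ[volume] g t := by
  have h1 := (measurePreserving_transport (-t)).quasiMeasurePreserving.ae_eq h
  filter_upwards [h1] with z hz
  simpa [pullback, transport] using hz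

end Stability

/-! ### Propagation of positivity. -/

section Nonneg

lemma exists_last_nonneg {φ : ℝ → ℝ} (hφ : Continuous φ) {t : ℝ} (ht : 0 ≤ t) (h0 : 0 ≤ φ 0) : ∃ t₀, 0 ≤ t₀ ∧ t₀ ≤ t ∧ 0 ≤ φ t₀ ∧ ∀ s, t₀ < s → s ≤ t → φ s < 0 := by
  have hc : IsCompact (Icc 0 t ∩ {s | 0 ≤ φ s}) :=
    isCompact_Icc.inter_right (isClosed_le continuous_const hφ)
  obtain ⟨t₀, ht₀, hmax⟩ := hc.exists_isGreatest ⟨0, ⟨le_rfl, ht⟩, h0⟩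
  refine ⟨t₀, ht₀.1.1, ht₀.1.2, ht₀.2, fun s hs hst => ?_⟩
  by_contra hcon
  exact absurd (hmax ⟨⟨ht₀.1.1.trans hs.le, hst⟩, not_lt.1 hcon⟩) (not_le.2 hs)

/-- Each factor is within `D` times its weight of its positive part, and the product of the positive
parts is nonnegative. -/
lemma neg_le_mul_mul {M D u v w a b c : ℝ} (hDM : 0 ≤ D)
    (ha : |a| ≤ M * u) (hb : |b| ≤ M * v) (hc : |c| ≤ M * w)
    (ha' : -(D * u) ≤ a) (hb' : -(D * v) ≤ b) (hc' : -(D * w) ≤ c)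
    (hu : 0 ≤ u) (hv : 0 ≤ v) (hw : 0 ≤ w) :
    -(3 * M ^ 2 * D * (u * v * w)) ≤ a * b * c := by
  have hmax : ∀ x y : ℝ, |x| ≤ y → |max x 0| ≤ y := fun x y h => by
    rw [abs_of_nonneg (le_max_right _ _)]
    exact max_le ((le_abs_self _).trans h) ((abs_nonneg _).trans h)
  have hdiff : ∀ x y : ℝ, 0 ≤ y → -y ≤ x → |x - max x 0| ≤ y := fun x y hy h => by
    rcases le_total 0 x with hx | hx
    · rw [max_eq_left hx, sub_self, abs_zero]; exact hy
    · rw [max_eq_right hx, sub_zero, abs_of_nonpos hx]; linarith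
  have h := abs_mul_mul_sub_le hb hc (hmax _ _ ha) (hmax _ _ hb)
    (hdiff _ _ (by positivity) ha') (hdiff _ _ (by positivity) hb') (hdiff _ _ (by positivity) hc')
  have h2 : 0 ≤ max a 0 * max b 0 * max c 0 := by positivity
  linarith [(abs_le.1 h).1]

/-- Where `F s z ≤ 0`, its absolute value is at most `D wt`, so the three terms that contain it are
small whatever their sign. The remaining term is almost nonnegative by `neg_le_mul_mul`. -/
lemma neg_le_colIntegrand {M D : ℝ} (hD : 0 ≤ D) {F : ℝ → R3 × R3 → ℝ} {s : ℝ}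
    (hF : ∀ z, |F s z| ≤ M * wt p q α β z) (hFD : ∀ z, -(D * wt p q α β z) ≤ F s z)
    {z : R3 × R3} (hz : F s z ≤ 0) (a : R3 × S2) :
    -(3 * M ^ 2 * D * kern p q α β s z a) ≤ colIntegrand F s z a := by
  unfold colIntegrand kern tripleSum quad
  set z₁ := along s z a.1
  set z₂ := along s z (vel2 z.2 a.1 a.2)
  set z₃ := along s z (vel3 z.2 a.1 a.2)
  have hw := fun y => (wt_pos (p := p) (q := q) (α := α) (β := β) y).le
  have h0 := neg_le_mul_mul hD (hF z₁) (hF z₂) (hF z₃) (hFD z₁) (hFD z₂) (hFD z₃) (hw _) (hw _)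
    (hw _)
  have hz' : |F s z| ≤ D * wt p q α β z := by
    rw [abs_of_nonpos hz]; linarith [hFD z]
  have hM2 : 0 ≤ M ^ 2 * D := by positivity
  have key : ∀ y w : R3 × R3, |F s z * F s y * F s w| ≤
      3 * M ^ 2 * D * (wt p q α β z * wt p q α β y * wt p q α β w) := fun y w => by
    rw [abs_mul, abs_mul]
    have hy := (abs_nonneg _).trans (hF y)
    have hDz := mul_nonneg hD (hw z)
    calc |F s z| * |F s y| * |F s w|
        ≤ D * wt p q α β z * (M * wt p q α β y) * (M * wt p q α β w) := by
          gcongr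
          · exact hF y
          · exact hF w
      _ = M ^ 2 * D * (wt p q α β z * wt p q α β y * wt p q α β w) := by ring
      _ ≤ _ := by
          have : 0 ≤ M ^ 2 * D * (wt p q α β z * wt p q α β y * wt p q α β w) :=
            mul_nonneg hM2 (mul_nonneg (mul_nonneg (hw _) (hw _)) (hw _))
          linarith
  have h1 := (abs_le.1 (key z₂ z₃)).1
  have h2 := (abs_le.1 (key z₁ z₃)).2
  have h3 := (abs_le.1 (key z₁ z₂)).2
  rw [mul_left_comm, ← mul_neg]
  refine mul_le_mul_of_nonneg_left ?_ (by positivity)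
  linarith

/-- After the last time `t₀ ≤ t` at which `F` is nonnegative at `z`, the lower bound
`neg_le_colIntegrand` applies throughout, and its time integral is at least `-(D/4) wt`. -/
lemma neg_le_of_fixedPoint (hp : 1 < p) (hq : 3 < q) (hα : 0 < α) (hβ : 0 < β) {M D : ℝ}
    (hD : 0 ≤ D) (hMC : 3 * M ^ 2 * constC p q α β ≤ 1 / 4) {f₀ : R3 × R3 → ℝ}
    (hf₀ : ∀ z, 0 ≤ f₀ z) {F : ℝ → R3 × R3 → ℝ} (hFm : Measurable (Function.uncurry F))
    (hF : WtBound p q α β M F) (hfix : ∀ t z, F t z = f₀ z + duhamel F t z)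
    (hFD : ∀ s, 0 ≤ s → ∀ z, -(D * wt p q α β z) ≤ F s z) {t : ℝ} (ht : 0 ≤ t) (z : R3 × R3) :
    -(D / 4 * wt p q α β z) ≤ F t z := by
  have hw := (wt_pos (p := p) (q := q) (α := α) (β := β) z).le
  rcases le_or_gt 0 (F t z) with hpos | _
  · exact le_trans (by simpa using mul_nonneg (by positivity) hw) hpos
  have hi := integrable_colFlow hp hq hα hβ hFm hF z
  have hcont : Continuous fun t => F t z := by
    simp_rw [hfix]
    exact continuous_const.add (intervalIntegral.continuous_primitive
      (fun a b => hi.intervalIntegrable) 0)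
  obtain ⟨t₀, h0, h1, h2, h3⟩ := exists_last_nonneg hcont ht
    (by simp only [hfix 0 z, duhamel, intervalIntegral.integral_same, add_zero]; exact hf₀ z)
  have hsub : F t z - F t₀ z = ∫ s in t₀..t, colFlow F s z := by
    rw [hfix t z, hfix t₀ z, add_sub_add_left_eq_sub]
    exact intervalIntegral.integral_interval_sub_left hi.intervalIntegrable hi.intervalIntegrable
  have hle : ∫ s in Ioc t₀ t, -(3 * M ^ 2 * D * kernFlow p q α β s z) ≤
      ∫ s in Ioc t₀ t, colFlow F s z := by
    refine setIntegral_mono_on_ae ((integrable_kernFlow hp hq hα hβ z).const_mul _).neg.integrableOn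
      hi.integrableOn measurableSet_Ioc ?_
    filter_upwards [(integrable_colIntegrand hp hq hα hβ hFm hF z).prod_right_ae,
      (integrable_kern hp hq hα hβ z).prod_right_ae] with s i1 i2 hs
    rw [kernFlow, colFlow, ← integral_const_mul, ← integral_neg]
    exact integral_mono (i2.const_mul _).neg i1 fun a => neg_le_colIntegrand hD (hF s)
      (hFD s (h0.trans hs.1.le)) (h3 s hs.1 hs.2).le a
  rw [integral_neg, integral_const_mul] at hle
  rw [intervalIntegral.integral_of_le h1] at hsub
  have hk := setIntegral_kernFlow_le hp hq hα hβ (Ioc t₀ t) z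
  have hk2 : 3 * M ^ 2 * D * ∫ s in Ioc t₀ t, kernFlow p q α β s z ≤
      D / 4 * wt p q α β z := by
    calc _ ≤ 3 * M ^ 2 * D * (constC p q α β * wt p q α β z) :=
          mul_le_mul_of_nonneg_left hk (by positivity)
      _ = 3 * M ^ 2 * constC p q α β * (D * wt p q α β z) := by ring
      _ ≤ 1 / 4 * (D * wt p q α β z) := by gcongr
      _ = _ := by ring
  linarith

lemma nonneg_of_fixedPoint (hp : 1 < p) (hq : 3 < q) (hα : 0 < α) (hβ : 0 < β) {M : ℝ}
    (hMC : 3 * M ^ 2 * constC p q α β ≤ 1 / 4) {f₀ : R3 × R3 → ℝ}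
    (hf₀ : ∀ z, 0 ≤ f₀ z) {F : ℝ → R3 × R3 → ℝ} (hFm : Measurable (Function.uncurry F))
    (hF : WtBound p q α β M F) (hfix : ∀ t z, F t z = f₀ z + duhamel F t z) {t : ℝ} (ht : 0 ≤ t)
    (z : R3 × R3) : 0 ≤ F t z := by
  have hM := hF.nonneg
  have iter : ∀ n : ℕ, ∀ s, 0 ≤ s → ∀ z, -(M * (1 / 4) ^ n * wt p q α β z) ≤ F s z := by
    intro n
    induction n with
    | zero => intro s _ z; simpa using (abs_le.1 (hF s z)).1
    | succ n ih =>
      intro s hs z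
      have := neg_le_of_fixedPoint hp hq hα hβ (by positivity) hMC hf₀ hFm hF hfix ih hs z
      refine le_of_eq_of_le ?_ this
      ring
  have hlim : Tendsto (fun n : ℕ => -(M * (1 / 4 : ℝ) ^ n * wt p q α β z)) atTop
      (𝓝 (-(M * 0 * wt p q α β z))) :=
    (((tendsto_pow_atTop_nhds_zero_of_lt_one (by norm_num) (by norm_num)).const_mul
      M).mul_const _).neg
  have := le_of_tendsto' hlim fun n => iter n t ht z
  simpa using this

end Nonneg

variable {E : Type*} [NormedAddCommGroup E] [NormedSpace ℝ E]

/-! ### Symmetries of the collision integral. -/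

section Symmetry

lemma quad_comm_left (a b c d : ℝ) : quad b a c d = quad a b c d := by
  unfold quad; ring

lemma quad_reverse (a b c d : ℝ) : quad c d a b = -quad a b c d := by
  unfold quad; ring

lemma integrable_integral_comp {A B : Type*} [MeasurableSpace A] [MeasurableSpace B]
    {μ : Measure A} {ν : Measure B} {S : A → B} (hS : MeasurePreserving S μ ν) {h : B → E}
    (hh : Integrable h ν) : Integrable (fun y => h (S y)) μ ∧ ∫ y, h (S y) ∂μ = ∫ y, h y ∂ν := by
  refine ⟨hS.integrable_comp_of_integrable hh, ?_⟩
  rw [← hS.map_eq, integral_map hS.measurable.aemeasurable]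
  rw [hS.map_eq]
  exact hh.aestronglyMeasurable

/-- Collisional invariants: the collision operator integrates to zero against them. -/
lemma integral_collision_invariant (g : R3 → ℝ) (φ : R3 → E)
    (hφ : ∀ v v₁ σ, φ v + φ v₁ = φ (vel2 v v₁ σ) + φ (vel3 v v₁ σ))
    (hi : Integrable (fun y : R3 × (R3 × S2) => (‖y.1 - y.2.1‖ / 8 * quad (g y.1) (g y.2.1)
      (g (vel2 y.1 y.2.1 y.2.2)) (g (vel3 y.1 y.2.1 y.2.2))) • φ y.1)
      ((volume : Measure R3).prod paramMeasure)) :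
    ∫ y : R3 × (R3 × S2), (‖y.1 - y.2.1‖ / 8 * quad (g y.1) (g y.2.1)
      (g (vel2 y.1 y.2.1 y.2.2)) (g (vel3 y.1 y.2.1 y.2.2))) • φ y.1
      ∂((volume : Measure R3).prod paramMeasure) = 0 := by
  set K : R3 × (R3 × S2) → ℝ := fun y => ‖y.1 - y.2.1‖ / 8 * quad (g y.1) (g y.2.1)
      (g (vel2 y.1 y.2.1 y.2.2)) (g (vel3 y.1 y.2.1 y.2.2)) with hK
  set μ := (volume : Measure R3).prod paramMeasure with hμ
  change Integrable (fun y => K y • φ y.1) μ at hi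
  change ∫ y, K y • φ y.1 ∂μ = 0
  have hS : MeasurePreserving (fun y : R3 × (R3 × S2) => (y.2.1, (y.1, y.2.2))) μ μ :=
    measurePreserving_leftComm (volume : Measure R3) (volume : Measure R3)
      (volume : Measure R3).toSphere
  have hKS : ∀ y : R3 × (R3 × S2), K (y.2.1, (y.1, y.2.2)) = K y := fun y => by
    simp only [hK]
    rw [vel2_comm, vel3_comm, norm_sub_rev, quad_comm_left]
  have hKR : ∀ y : R3 × (R3 × S2), K (collisionMap y) = -K y := fun y => by
    simp only [hK]
    rw [vel2_collisionMap, vel3_collisionMap]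
    simp only [collisionMap]
    rw [norm_vel2_sub_vel3, quad_reverse, mul_neg]
  obtain ⟨i1, e1⟩ := integrable_integral_comp hS hi
  simp only [hKS] at i1 e1
  obtain ⟨i2, e2⟩ := integrable_integral_comp measurePreserving_collisionMap hi
  obtain ⟨i3, e3⟩ := integrable_integral_comp measurePreserving_collisionMap i1
  simp only [hKR] at i2 e2 i3 e3
  -- The exchange of `v` and `v₁` preserves `K` and the reversal of the collision changes its sign,
  -- so these four terms have equal integrals, while their sum vanishes pointwise.
  have hsum : ∀ y, K y • φ y.1 + K y • φ y.2.1 + (-K y) • φ (collisionMap y).1 +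
      (-K y) • φ (collisionMap y).2.1 = 0 := fun y => by
    have := hφ y.1 y.2.1 y.2.2
    have e : (collisionMap y).1 = vel2 y.1 y.2.1 y.2.2 := rfl
    have e' : (collisionMap y).2.1 = vel3 y.1 y.2.1 y.2.2 := rfl
    rw [e, e', ← smul_add, this, smul_add]
    module
  have h01 : Integrable (fun y => K y • φ y.1 + K y • φ y.2.1) μ := hi.add i1
  have h02 : Integrable (fun y => K y • φ y.1 + K y • φ y.2.1 +
    (-K y) • φ (collisionMap y).1) μ := h01.add i2
  have htot : ∫ y, (K y • φ y.1 + K y • φ y.2.1 + (-K y) • φ (collisionMap y).1 +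
      (-K y) • φ (collisionMap y).2.1) ∂μ = 0 := by
    simp only [hsum, integral_zero]
  rw [integral_add h02 i3, integral_add h01 i2, integral_add hi i1, e2, e3, e1] at htot
  have h4 : (4 : ℝ) • ∫ y, K y • φ y.1 ∂μ = 0 := by
    rw [← htot]; module
  exact (smul_eq_zero.1 h4).resolve_left (by norm_num)

end Symmetry

/-! ### Conservation laws. -/

section Conservation

lemma along_transport (s : ℝ) (x v w : R3) : along s (x + -s • v, v) w = (x + -s • w, w) := by
  simp only [along, Prod.mk.injEq, and_true]
  module

/-- Undoing the transport puts all four particles of a collision at the same position at time `s`.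
For almost every such position the claim is then the spatially homogeneous one. -/
lemma integral_colIntegrand_smul_eq_zero (F : ℝ → R3 × R3 → ℝ) (s : ℝ) (φ : R3 → E)
    (hφ : ∀ v v₁ σ, φ v + φ v₁ = φ (vel2 v v₁ σ) + φ (vel3 v v₁ σ))
    (hi : Integrable (fun y : (R3 × R3) × (R3 × S2) => colIntegrand F s y.1 y.2 • φ y.1.2)
      ((volume : Measure (R3 × R3)).prod paramMeasure)) :
    ∫ y : (R3 × R3) × (R3 × S2), colIntegrand F s y.1 y.2 • φ y.1.2
      ∂((volume : Measure (R3 × R3)).prod paramMeasure) = 0 := by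
  have hA : MeasurePreserving MeasurableEquiv.prodAssoc
      (((volume : Measure R3).prod (volume : Measure R3)).prod paramMeasure)
      ((volume : Measure R3).prod ((volume : Measure R3).prod paramMeasure)) :=
    ⟨MeasurableEquiv.measurable _, Measure.prodAssoc_prod⟩
  have hT := ((measurePreserving_transport (-s)).prod (MeasurePreserving.id paramMeasure)).comp
    hA.symm
  obtain ⟨i1, e1⟩ := integrable_integral_comp hT hi
  rw [← e1, integral_prod _ i1]
  refine integral_eq_zero_of_ae ?_
  filter_upwards [i1.prod_right_ae] with x hx
  have hv : ∀ y : R3 × (R3 × S2), colIntegrand F s (x + -s • y.1, y.1) y.2 =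
      ‖y.1 - y.2.1‖ / 8 * quad (F s (x + -s • y.1, y.1)) (F s (x + -s • y.2.1, y.2.1))
      (F s (x + -s • (vel2 y.1 y.2.1 y.2.2), vel2 y.1 y.2.1 y.2.2))
      (F s (x + -s • (vel3 y.1 y.2.1 y.2.2), vel3 y.1 y.2.1 y.2.2)) := fun y => by
    simp only [colIntegrand, along_transport]
  have hy : ∀ y : R3 × (R3 × S2),
      (Prod.map (fun z : R3 × R3 => (z.1 + -s • z.2, z.2)) id ∘
        MeasurableEquiv.prodAssoc.symm) (x, y) = ((x + -s • y.1, y.1), y.2) := fun y => rfl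
  simp only [hy, hv] at hx ⊢
  exact integral_collision_invariant (fun w => F s (x + -s • w, w)) φ hφ hx

/-- Since `φ` depends only on `v`, integrating over time and collision parameters first leaves a
multiple of the weight times `‖φ‖`; no moment in the other velocities is needed. -/
lemma integrable_colIntegrand_smul (hp : 1 < p) (hq : 3 < q) (hα : 0 < α) (hβ : 0 < β) {M : ℝ}
    {F : ℝ → R3 × R3 → ℝ} (hFm : Measurable (Function.uncurry F)) (hF : WtBound p q α β M F)
    {φ : R3 → E} (hφc : Continuous φ) [SecondCountableTopology E] [MeasurableSpace E] [BorelSpace E]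
    (hφw : Integrable fun z : R3 × R3 => wt p q α β z * ‖φ z.2‖) :
    Integrable (fun y : (R3 × R3) × (ℝ × (R3 × S2)) => colIntegrand F y.2.1 y.1 y.2.2 • φ y.1.2)
      ((volume : Measure (R3 × R3)).prod ((volume : Measure ℝ).prod paramMeasure)) := by
  have hM := hF.nonneg
  have hBm : Measurable fun y : (R3 × R3) × (ℝ × (R3 × S2)) =>
      colIntegrand F y.2.1 y.1 y.2.2 :=
    measurable_colIntegrand_comp hFm (by fun_prop) (by fun_prop) (by fun_prop)
  have hφm : Measurable φ := hφc.measurable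
  have hm : AEStronglyMeasurable (fun y : (R3 × R3) × (ℝ × (R3 × S2)) =>
      colIntegrand F y.2.1 y.1 y.2.2 • φ y.1.2)
      ((volume : Measure (R3 × R3)).prod ((volume : Measure ℝ).prod paramMeasure)) :=
    (hBm.smul (hφm.comp (by fun_prop))).aestronglyMeasurable
  refine (integrable_prod_iff hm).2 ⟨Eventually.of_forall fun z =>
    (integrable_colIntegrand hp hq hα hβ hFm hF z).smul_const (φ z.2), ?_⟩
  refine (hφw.const_mul (3 * M ^ 3 * constC p q α β)).mono'
    hm.norm.integral_prod_right' (Eventually.of_forall fun z => ?_)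
  rw [Real.norm_of_nonneg (integral_nonneg fun _ => norm_nonneg _)]
  have hk := integrable_kern hp hq hα hβ z
  calc ∫ y : ℝ × (R3 × S2), ‖colIntegrand F y.1 z y.2 • φ z.2‖
        ∂((volume : Measure ℝ).prod paramMeasure)
      ≤ ∫ y : ℝ × (R3 × S2), 3 * M ^ 3 * ‖φ z.2‖ * kern p q α β y.1 z y.2
        ∂((volume : Measure ℝ).prod paramMeasure) := by
        refine integral_mono ((integrable_colIntegrand hp hq hα hβ hFm hF z).smul_const _).norm
          (hk.const_mul _) fun y => ?_
        dsimp only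
        rw [norm_smul, Real.norm_eq_abs, mul_right_comm]
        exact mul_le_mul_of_nonneg_right (abs_colIntegrand_le hF _ _ _) (norm_nonneg _)
    _ = 3 * M ^ 3 * ‖φ z.2‖ * ∫ s, kernFlow p q α β s z := by
        rw [integral_const_mul, integral_prod _ hk]
        rfl
    _ ≤ 3 * M ^ 3 * ‖φ z.2‖ * (constC p q α β * wt p q α β z) :=
        mul_le_mul_of_nonneg_left (integral_kernFlow_le hp hq hα hβ z) (by positivity)
    _ = _ := by ring

lemma integrable_integral_duhamel_smul (hp : 1 < p) (hq : 3 < q) (hα : 0 < α) (hβ : 0 < β) {M : ℝ}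
    {F : ℝ → R3 × R3 → ℝ} (hFm : Measurable (Function.uncurry F)) (hF : WtBound p q α β M F)
    {φ : R3 → E} (hφc : Continuous φ) [SecondCountableTopology E] [CompleteSpace E]
    [MeasurableSpace E] [BorelSpace E] (hφ : ∀ v v₁ σ, φ v + φ v₁ = φ (vel2 v v₁ σ) + φ (vel3 v v₁ σ))
    (hφw : Integrable fun z : R3 × R3 => wt p q α β z * ‖φ z.2‖) {t : ℝ} (ht : 0 ≤ t) :
    Integrable (fun z : R3 × R3 => duhamel F t z • φ z.2) ∧
      ∫ z : R3 × R3, duhamel F t z • φ z.2 = 0 := by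
  have hI : Integrable (fun y : (R3 × R3) × (ℝ × (R3 × S2)) =>
      colIntegrand F y.2.1 y.1 y.2.2 • φ y.1.2)
      ((volume : Measure (R3 × R3)).prod
        ((volume.restrict (Ioc 0 t) : Measure ℝ).prod paramMeasure)) :=
    (integrable_colIntegrand_smul hp hq hα hβ hFm hF hφc hφw).mono_measure
      (Measure.prod_mono le_rfl (Measure.prod_mono Measure.restrict_le_self le_rfl))
  have hz : ∀ z : R3 × R3, duhamel F t z • φ z.2 = ∫ y : ℝ × (R3 × S2),
      colIntegrand F y.1 z y.2 • φ z.2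
        ∂((volume.restrict (Ioc 0 t) : Measure ℝ).prod paramMeasure) := fun z => by
    have hi : Integrable (fun y : ℝ × (R3 × S2) => colIntegrand F y.1 z y.2)
        ((volume.restrict (Ioc 0 t)).prod paramMeasure) :=
      (integrable_colIntegrand hp hq hα hβ hFm hF z).mono_measure
        (Measure.prod_mono Measure.restrict_le_self le_rfl)
    rw [integral_smul_const, integral_prod _ hi, duhamel, intervalIntegral.integral_of_le ht]
    rfl
  simp_rw [hz]
  refine ⟨hI.integral_prod_left, ?_⟩
  rw [← integral_prod _ hI]
  -- Time is moved outermost, because the cancellation takes place at each fixed time.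
  have hL := measurePreserving_leftComm (volume.restrict (Ioc 0 t) : Measure ℝ)
    (volume : Measure (R3 × R3)) paramMeasure
  obtain ⟨i1, e1⟩ := integrable_integral_comp hL hI
  rw [← e1, integral_prod _ i1]
  refine integral_eq_zero_of_ae ?_
  filter_upwards [i1.prod_right_ae] with s hs
  exact integral_colIntegrand_smul_eq_zero F s φ hφ hs

lemma integrable_smul_of_wtBound {M : ℝ} {h : R3 × R3 → ℝ}
    (hh : AEStronglyMeasurable h volume) (hM : ∀ᵐ z, |h z| ≤ M * wt p q α β z)
    {φ : R3 → E} (hφc : Continuous φ) [SecondCountableTopology E] [MeasurableSpace E] [BorelSpace E]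
    (hφw : Integrable fun z : R3 × R3 => wt p q α β z * ‖φ z.2‖) :
    Integrable fun z : R3 × R3 => h z • φ z.2 := by
  have hφm : Measurable φ := hφc.measurable
  refine (hφw.const_mul M).mono'
    (hh.smul (hφm.comp measurable_snd).aestronglyMeasurable) ?_
  filter_upwards [hM] with z hz
  rw [norm_smul, Real.norm_eq_abs, ← mul_assoc]
  exact mul_le_mul_of_nonneg_right hz (norm_nonneg _)

lemma conservation (hp : 1 < p) (hq : 3 < q) (hα : 0 < α) (hβ : 0 < β) {T M : ℝ} (hM : 0 ≤ M)
    {f₀ : R3 × R3 → ℝ} (hf₀ : MemX p q α β f₀) {f : ℝ → R3 × R3 → ℝ}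
    (hf : IsMildSolution p q α β T f₀ f)
    (hfM : ∀ t ∈ Icc 0 T, ∀ᵐ z, |pullback f t z| ≤ M * wt p q α β z)
    {φ : R3 → E} (hφc : Continuous φ) [SecondCountableTopology E] [CompleteSpace E]
    [MeasurableSpace E] [BorelSpace E] (hφ : ∀ v v₁ σ, φ v + φ v₁ = φ (vel2 v v₁ σ) + φ (vel3 v v₁ σ))
    (hφw : Integrable fun z : R3 × R3 => wt p q α β z * ‖φ z.2‖) :
    Integrable (fun z : R3 × R3 => f₀ z • φ z.2) ∧ ∀ t ∈ Icc 0 T,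
      Integrable (fun z : R3 × R3 => f t z • φ z.2) ∧
        ∫ z : R3 × R3, f t z • φ z.2 = ∫ z : R3 × R3, f₀ z • φ z.2 := by
  have h0 := integrable_smul_of_wtBound hf₀.1 (ae_abs_le_of_wNorm_lt_top hf₀.2) hφc hφw
  refine ⟨h0, fun t ht => ?_⟩
  -- The solution is paired with itself; only one representative is used.
  obtain ⟨F, G, hFm, hGm, hF, hG, hFG, eF, eG⟩ :=
    exists_pair_representatives (D := 0) hM le_rfl hf hf hfM hfM
      (fun t _ => Eventually.of_forall fun z => by simp)
  obtain ⟨i1, e1⟩ := integrable_integral_duhamel_smul hp hq hα hβ hFm hF hφc hφ hφw ht.1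
  have hae : (fun z : R3 × R3 => pullback f t z • φ z.2) =ᵐ[volume]
      fun z => f₀ z • φ z.2 + duhamel F t z • φ z.2 := by
    filter_upwards [eF t ht] with z hz
    rw [hz, add_smul]
  have i2 : Integrable fun z : R3 × R3 => pullback f t z • φ z.2 := (h0.add i1).congr hae.symm
  have e2 : ∫ z : R3 × R3, pullback f t z • φ z.2 = ∫ z : R3 × R3, f₀ z • φ z.2 := by
    rw [integral_congr_ae hae, integral_add h0 i1, e1, add_zero]
  obtain ⟨i3, e3⟩ := integrable_integral_comp (measurePreserving_transport (-t)) i2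
  have hpt : ∀ z : R3 × R3, pullback f t (z.1 + -t • z.2, z.2) = f t z := fun z => by
    simp [pullback, transport]
  simp only [hpt] at i3 e3
  exact ⟨i3, e3.trans e2⟩

lemma integrable_wt_mul_norm_of_le {E : Type*} [NormedAddCommGroup E] (hp : 3 < p) (hα : 0 < α) (hβ : 0 < β) {k : ℝ} (hq : 3 + k < q)
    {φ : R3 → E} (hφc : Continuous φ) {c : ℝ} (hφ : ∀ v, ‖φ v‖ ≤ c * bracket (β • v) ^ k) :
    Integrable fun z : R3 × R3 => wt p q α β z * ‖φ z.2‖ := by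
  have h1 := (integrable_bracket_rpow hα hp).1
  have h2 := (integrable_bracket_rpow (q := q - k) hβ (by linarith)).1
  refine ((h1.mul_prod h2).const_mul c).mono' (by fun_prop) (Eventually.of_forall fun z => ?_)
  rw [Real.norm_of_nonneg (mul_nonneg (wt_pos z).le (norm_nonneg _))]
  refine (mul_le_mul_of_nonneg_left (hφ z.2) (wt_pos z).le).trans_eq ?_
  have e : bracket (β • z.2) ^ (-(q - k)) = bracket (β • z.2) ^ (-q) * bracket (β • z.2) ^ k := by
    rw [← Real.rpow_add (bracket_pos _)]
    congr 1; ring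
  rw [e, wt]
  ring

lemma norm_le_bracket (hβ : 0 < β) (v : R3) : ‖v‖ ≤ β⁻¹ * bracket (β • v) := by
  rw [← div_eq_inv_mul, le_div_iff₀ hβ]
  refine Real.le_sqrt_of_sq_le ?_
  rw [norm_smul, Real.norm_of_nonneg hβ.le]
  nlinarith

end Conservation

/-! ### Assembly of the theorem. -/

lemma three_mul_sq_mul_constC_le (hp : 1 < p) (hq : 3 < q) (hα : 0 < α) (hβ : 0 < β) {M : ℝ}
    (hM : 0 < M) (hMC : M < (24 * constC p q α β) ^ (-(1 / 2 : ℝ))) :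
    3 * M ^ 2 * constC p q α β ≤ 1 / 4 := by
  have hC := constC_pos hp hq hα hβ
  have h1 : M ^ 2 ≤ ((24 * constC p q α β) ^ (-(1 / 2 : ℝ))) ^ 2 := by gcongr
  rw [← Real.rpow_natCast (_ ^ _), ← Real.rpow_mul (by positivity)] at h1
  norm_num at h1
  rw [Real.rpow_neg_one] at h1
  have h2 : M ^ 2 * (24 * constC p q α β) ≤ 1 := by
    rwa [← le_div_iff₀ (by positivity), one_div]
  -- The bound obtained is in fact `1/8`; the weaker `1/4` suffices everywhere.
  linarith

lemma exists_isMildSolution (hp : 1 < p) (hq : 3 < q) (hα : 0 < α) (hβ : 0 < β) {M : ℝ}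
    (hM : 0 ≤ M) (hMC : 3 * M ^ 2 * constC p q α β ≤ 1 / 4) (T : ℝ) {f₀ : R3 × R3 → ℝ}
    (hf₀ : MemX p q α β f₀) (hf₀M : wNorm p q α β f₀ ≤ ENNReal.ofReal (M / 2)) :
    ∃ f : ℝ → R3 × R3 → ℝ, IsMildSolution p q α β T f₀ f ∧
      wNormT p q α β T (pullback f) ≤ ENNReal.ofReal M ∧
      (0 ≤ᵐ[volume] f₀ → ∀ t ∈ Icc 0 T, ∀ z, 0 ≤ f t z) := by
  obtain ⟨g₀, hg₀m, hg₀f, hg₀M, hg₀n⟩ := exists_measurable_modification (by positivity) hf₀.1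
    ((wNorm_le_iff (by positivity) f₀).1 hf₀M)
  obtain ⟨F, hFm, hF, hfix⟩ := exists_fixedPoint hp hq hα hβ hM hMC hg₀m hg₀M
  refine ⟨fun t => transport t (F t), isMildSolution_of_fixedPoint hp hq hα hβ hg₀f hFm hF hfix T,
    ?_, fun h t ht z => nonneg_of_fixedPoint hp hq hα hβ hMC (hg₀n h) hFm hF hfix ht.1 _⟩
  rw [pullback_transport]
  exact (wNormT_le_iff hM T F).2 fun t _ => Eventually.of_forall (hF t)

lemma isMildSolution_zero (hp : 1 < p) (hq : 3 < q) (hα : 0 < α) (hβ : 0 < β) (T : ℝ) :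
    IsMildSolution p q α β T 0 0 :=
  isMildSolution_of_fixedPoint (M := 0) (g₀ := 0) (F := 0) hp hq hα hβ (ae_eq_refl _)
    measurable_const (wtBound_zero le_rfl) (fun t z => by simp [duhamel_zero]) T

lemma wNormT_sub_le (hp : 1 < p) (hq : 3 < q) (hα : 0 < α) (hβ : 0 < β) {T M : ℝ} (hM : 0 ≤ M)
    (hMC : 3 * M ^ 2 * constC p q α β ≤ 1 / 4) {f₀ g₀ : R3 × R3 → ℝ} {f g : ℝ → R3 × R3 → ℝ}
    (hf₀M : wNorm p q α β f₀ ≤ ENNReal.ofReal (M / 2))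
    (hg₀M : wNorm p q α β g₀ ≤ ENNReal.ofReal (M / 2))
    (hf : IsMildSolution p q α β T f₀ f) (hg : IsMildSolution p q α β T g₀ g)
    (hfM : wNormT p q α β T (pullback f) ≤ ENNReal.ofReal M)
    (hgM : wNormT p q α β T (pullback g) ≤ ENNReal.ofReal M) :
    wNormT p q α β T (pullback f - pullback g) ≤ 2 * wNorm p q α β (f₀ - g₀) := by
  have hM2 : 0 ≤ M / 2 := by positivity
  have hfin : wNorm p q α β (f₀ - g₀) < ∞ := by
    refine lt_of_le_of_lt ((wNorm_le_iff hM _).2 ?_) ENNReal.ofReal_lt_top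
    filter_upwards [(wNorm_le_iff hM2 _).1 hf₀M, (wNorm_le_iff hM2 _).1 hg₀M] with z h1 h2
    refine (abs_sub _ _).trans ?_
    linarith
  have e : 2 * wNorm p q α β (f₀ - g₀) =
      ENNReal.ofReal (2 * (wNorm p q α β (f₀ - g₀)).toReal) := by
    rw [ENNReal.ofReal_mul (by norm_num), ENNReal.ofReal_toReal hfin.ne, ENNReal.ofReal_ofNat]
  rw [e, wNormT_le_iff (by positivity)]
  exact ae_abs_sub_le_of_isMildSolution hp hq hα hβ hM hMC ENNReal.toReal_nonneg hf hg
    ((wNormT_le_iff hM T _).1 hfM) ((wNormT_le_iff hM T _).1 hgM)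
    (ae_abs_le_of_wNorm_lt_top hfin)

lemma ae_eq_of_isMildSolution (hp : 1 < p) (hq : 3 < q) (hα : 0 < α) (hβ : 0 < β) {T M : ℝ}
    (hM : 0 ≤ M) (hMC : 3 * M ^ 2 * constC p q α β ≤ 1 / 4) {f₀ : R3 × R3 → ℝ}
    {f g : ℝ → R3 × R3 → ℝ} (hf : IsMildSolution p q α β T f₀ f)
    (hg : IsMildSolution p q α β T f₀ g)
    (hfM : wNormT p q α β T (pullback f) ≤ ENNReal.ofReal M)
    (hgM : wNormT p q α β T (pullback g) ≤ ENNReal.ofReal M) :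
    ∀ t ∈ Icc 0 T, f t =ᵐ[volume] g t := by
  intro t ht
  refine ae_eq_of_pullback_ae_eq ?_
  have h := ae_abs_sub_le_of_isMildSolution hp hq hα hβ hM hMC le_rfl hf hg
    ((wNormT_le_iff hM T _).1 hfM) ((wNormT_le_iff hM T _).1 hgM)
    (Eventually.of_forall fun z => by simp) t ht
  filter_upwards [h] with z hz
  rw [mul_zero, zero_mul, abs_nonpos_iff, sub_eq_zero] at hz
  exact hz

end WaveKinetic

theorem mainTheorem1 (p q α β T M : ℝ) (hp : 1 < p) (hq : 3 < q) (hα : 0 < α) (hβ : 0 < β)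
    (hT : 0 < T) (hM : 0 < M)
    (hMC : M < (24 * WaveKinetic.constC p q α β) ^ (-(1 / 2 : ℝ)))
    (f₀ : WaveKinetic.R3 × WaveKinetic.R3 → ℝ) (hf₀ : WaveKinetic.MemX p q α β f₀)
    (hf₀M : WaveKinetic.wNorm p q α β f₀ ≤ ENNReal.ofReal (M / 2)) :
    -- existence
    (∃ f : ℝ → WaveKinetic.R3 × WaveKinetic.R3 → ℝ,
      WaveKinetic.IsMildSolution p q α β T f₀ f ∧
      WaveKinetic.wNormT p q α β T (WaveKinetic.pullback f) ≤ ENNReal.ofReal M) ∧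
    -- properties of the solution
    (∀ f : ℝ → WaveKinetic.R3 × WaveKinetic.R3 → ℝ,
      WaveKinetic.IsMildSolution p q α β T f₀ f →
      WaveKinetic.wNormT p q α β T (WaveKinetic.pullback f) ≤ ENNReal.ofReal M →
      -- uniqueness
      (∀ g : ℝ → WaveKinetic.R3 × WaveKinetic.R3 → ℝ,
        WaveKinetic.IsMildSolution p q α β T f₀ g →
        WaveKinetic.wNormT p q α β T (WaveKinetic.pullback g) ≤ ENNReal.ofReal M →
        ∀ t ∈ Icc 0 T, f t =ᵐ[volume] g t) ∧
      -- non-negativity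
      (0 ≤ᵐ[volume] f₀ → ∀ t ∈ Icc 0 T, 0 ≤ᵐ[volume] f t) ∧
      -- stability
      (∀ g₀ : WaveKinetic.R3 × WaveKinetic.R3 → ℝ, WaveKinetic.MemX p q α β g₀ →
        WaveKinetic.wNorm p q α β g₀ ≤ ENNReal.ofReal (M / 2) →
        ∀ g : ℝ → WaveKinetic.R3 × WaveKinetic.R3 → ℝ,
          WaveKinetic.IsMildSolution p q α β T g₀ g →
          WaveKinetic.wNormT p q α β T (WaveKinetic.pullback g) ≤ ENNReal.ofReal M →
          WaveKinetic.wNormT p q α β T (WaveKinetic.pullback f - WaveKinetic.pullback g)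
            ≤ 2 * WaveKinetic.wNorm p q α β (f₀ - g₀)) ∧
      -- bound by the initial data
      WaveKinetic.wNormT p q α β T (WaveKinetic.pullback f) ≤ 2 * WaveKinetic.wNorm p q α β f₀ ∧
      -- conservation of mass
      (3 < p → 4 < q → Integrable f₀ volume ∧ ∀ t ∈ Icc 0 T, Integrable (f t) volume ∧
        ∫ z, f t z = ∫ z, f₀ z) ∧
      -- conservation of momentum
      (3 < p → 5 < q → Integrable (fun z => f₀ z • z.2) volume ∧
        ∀ t ∈ Icc 0 T, Integrable (fun z => f t z • z.2) volume ∧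
          ∫ z, f t z • z.2 = ∫ z, f₀ z • z.2) ∧
      -- conservation of energy
      (3 < p → 6 < q → Integrable (fun z => ‖z.2‖ ^ 2 * f₀ z) volume ∧
        ∀ t ∈ Icc 0 T, Integrable (fun z => ‖z.2‖ ^ 2 * f t z) volume ∧
          ∫ z, ‖z.2‖ ^ 2 * f t z = ∫ z, ‖z.2‖ ^ 2 * f₀ z)) := by
  have hK := WaveKinetic.three_mul_sq_mul_constC_le hp hq hα hβ hM hMC
  obtain ⟨F, hF, hFM, hFn⟩ := WaveKinetic.exists_isMildSolution hp hq hα hβ hM.le hK T hf₀ hf₀M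
  refine ⟨⟨F, hF, hFM⟩, fun f hf hfM => ?_⟩
  have hfM' := (WaveKinetic.wNormT_le_iff hM.le T _).1 hfM
  have huniq := fun g hg hgM =>
    WaveKinetic.ae_eq_of_isMildSolution hp hq hα hβ hM.le hK (g := g) hf hg hfM hgM
  refine ⟨huniq, ?_, ?_, ?_, ?_, ?_, ?_⟩
  · intro h t ht
    filter_upwards [huniq F hF hFM t ht] with z hz
    rw [hz]
    exact hFn h t ht z
  · intro g₀ _ hg₀M g hg hgM
    exact WaveKinetic.wNormT_sub_le hp hq hα hβ hM.le hK hf₀M hg₀M hf hg hfM hgM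
  -- The bound by the data is stability against the zero solution.
  · have hpull : WaveKinetic.pullback 0 = 0 := rfl
    have h := WaveKinetic.wNormT_sub_le hp hq hα hβ hM.le hK hf₀M (g₀ := 0)
      ((WaveKinetic.wNorm_le_iff (by positivity) _).2 (Eventually.of_forall fun z => by
        simpa using mul_nonneg (by positivity) (WaveKinetic.wt_pos z).le)) hf
      (WaveKinetic.isMildSolution_zero hp hq hα hβ T) hfM
      ((WaveKinetic.wNormT_le_iff hM.le T _).2 fun t _ => Eventually.of_forall
        (WaveKinetic.wtBound_zero hM.le t))
    rwa [hpull, sub_zero, sub_zero] at h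
  · intro hp3 hq4
    have h := WaveKinetic.conservation hp hq hα hβ hM.le hf₀ hf hfM'
      (φ := fun _ => (1 : ℝ)) continuous_const (fun _ _ _ => rfl)
      (WaveKinetic.integrable_wt_mul_norm_of_le (k := 0) (c := 1) hp3 hα hβ (by linarith)
        continuous_const fun v => by simp)
    simpa only [smul_eq_mul, mul_one] using h
  · intro hp3 hq5
    exact WaveKinetic.conservation hp hq hα hβ hM.le hf₀ hf hfM'
      (φ := fun v => v) continuous_id (fun v v₁ σ => (WaveKinetic.vel2_add_vel3 v v₁ σ).symm)
      (WaveKinetic.integrable_wt_mul_norm_of_le (k := 1) (c := β⁻¹) hp3 hα hβ (by linarith)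
        continuous_id fun v => by
          rw [Real.rpow_one]; exact WaveKinetic.norm_le_bracket hβ v)
  · intro hp3 hq6
    have h := WaveKinetic.conservation hp hq hα hβ hM.le hf₀ hf hfM'
      (φ := fun v => ‖v‖ ^ 2) (by fun_prop)
      (fun v v₁ σ => (WaveKinetic.norm_vel2_sq_add_norm_vel3_sq v v₁ σ).symm)
      (WaveKinetic.integrable_wt_mul_norm_of_le (q := q) (k := 2) (c := (β⁻¹) ^ 2)
        (φ := fun v => ‖v‖ ^ 2) hp3 hα hβ (by linarith) (by fun_prop) fun v => by
          rw [Real.rpow_ofNat, ← mul_pow, norm_pow, norm_norm]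
          exact pow_le_pow_left₀ (norm_nonneg _) (WaveKinetic.norm_le_bracket hβ v) 2)
    simpa only [smul_eq_mul, mul_comm] using h
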